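/- Let $S^1=\mathbb R/2\pi\mathbb Z$ and let $\operatorname{Imm}(S^1,\mathbb R^2)$ be the set of all $c\in C^\infty(S^1,\mathbb R^2)$ with $c'(\theta)\neq 0$ for all $\theta$, an open subset of the Fréchet space $C^\infty(S^1,\mathbb R^2)$, so that $T_c\operatorname{Imm}=C^\infty(S^1,\mathbb R^2)$. For $c\in\operatorname{Imm}(S^1,\mathbb R^2)$ write $ds=|c'|\,d\theta$, $D_s=D_c=|c'|^{-1}\partial_\theta$, $v=D_sc$, $n_c=Jv$ with $J$ the rotation by $\pi/2$, and $\kappa=\langle D_sv,n_c\rangle$ for the curvature. Let $G$ be a smooth (weak) Riemannian metric on $\operatorname{Imm}(S^1,\mathbb R^2)$ and let $\operatorname{dist}^G(c_1,c_2)\in[0,\infty]$ be its geodesic distance, i.e. the infimum of $\int_0^1\sqrt{G_{c}(c_t,c_t)}\,dt$ over all smooth paths $c(t,\cdot)$ in $\operatorname{Imm}(S^1,\mathbb R^2)$ from $c_1$ to $c_2$ ($\infty$ if there are none). Let $n\ge 2$. (a) Assume that for some $A>0$, for all $c\in\operatorname{Imm}(S^1,\mathbb R^2)$ and $h\in T_c\operatorname{Imm}$,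 $$\int_{S^1}|h|^2+|D_s^nh|^2\,ds\le A\,G_c(h,h).$$ Then for each $c_0\in\operatorname{Imm}(S^1,\mathbb R^2)$ and $N>0$ there is a constant $C=C(c_0,N)$ such that for all $c_1,c_2\in\operatorname{Imm}(S^1,\mathbb R^2)$ with $\operatorname{dist}^G(c_0,c_i)<N$, $i=1,2$, and all $0\le k\le n-2$, $$\left\|(D_{c_1}^k\kappa_1)\sqrt{|c_1'|}-(D_{c_2}^k\kappa_2)\sqrt{|c_2'|}\right\|_{L^2(d\theta)}\le C\operatorname{dist}^G(c_1,c_2),$$ $$\left\|(D_{c_1}^{k+1}\log|c_1'|)\sqrt{|c_1'|}-(D_{c_2}^{k+1}\log|c_2'|)\sqrt{|c_2'|}\right\|_{L^2(d\theta)}\le C\operatorname{dist}^G(c_1,c_2).$$ In particular, for $0\le k\le n-2$ the maps $c\mapsto(D_s^k\kappa)\sqrt{|c'|}$ and $c\mapsto(D_s^{k+1}\log|c'|)\sqrt{|c'|}$ from $(\operatorname{Imm}(S^1,\mathbb R^2),\operatorname{dist}^G)$ to $L^2(S^1,\mathbb R)$ are continuous and Lipschitz continuous on every metric ball. (b) The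 conclusion of (a) holds for every Sobolev-type metric of order $n$ with constant coefficients, $G_c(h,k)=\int_{S^1}\sum_{j=0}^na_j\langle D_s^jh,D_s^jk\rangle\,ds$ with $a_j\ge 0$ and $a_0,a_n\ne 0$. -/

import Mathlib

open MeasureTheory
open scoped ContDiff ENNReal NNReal RealInnerProductSpace

noncomputable section

namespace PlaneCurves

/-- The Euclidean plane. -/
abbrev Plane : Type := EuclideanSpace ℝ (Fin 2)

/-- `C^∞(S¹, F)`, where `S¹ = ℝ / 2πℤ` and a function on `S¹` is a `2π`-periodic function on `ℝ`. -/
def Loop (F : Type*) [NormedAddCommGroup F] [NormedSpace ℝ F] : Submodule ℝ (ℝ → F) where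
  carrier := {f | ContDiff ℝ ∞ f ∧ Function.Periodic f (2 * Real.pi)}
  add_mem' hf hg := ⟨hf.1.add hg.1, hf.2.add hg.2⟩
  zero_mem' := ⟨contDiff_const, fun _ => rfl⟩
  smul_mem' a f hf := ⟨contDiff_const.smul hf.1, fun x => by simp [hf.2 x]⟩

section Basic

variable {F : Type*} [NormedAddCommGroup F] [NormedSpace ℝ F]

instance : CoeFun (Loop F) (fun _ => ℝ → F) := ⟨Subtype.val⟩

theorem loop_contDiff (f : Loop F) : ContDiff ℝ ∞ (f : ℝ → F) := f.2.1

theorem loop_periodic (f : Loop F) : Function.Periodic (f : ℝ → F) (2 * Real.pi) := f.2.2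

theorem contDiff_deriv {f : ℝ → F} (hf : ContDiff ℝ ∞ f) : ContDiff ℝ ∞ (deriv f) :=
  (contDiff_infty_iff_deriv.1 hf).2

theorem periodic_deriv {f : ℝ → F} {T : ℝ} (hf : Function.Periodic f T) :
    Function.Periodic (deriv f) T := by
  intro x
  rw [← deriv_comp_add_const]
  congr 1
  exact funext hf

/-- `Imm(S¹, ℝ²)`: the smooth closed plane curves whose derivative vanishes nowhere. -/
def Imm : Type := {c : Loop Plane // ∀ θ, deriv c θ ≠ 0}

namespace Imm

/-- The underlying element of `C^∞(S¹, ℝ²)`. -/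
def toLoop (c : Imm) : Loop Plane := c.1

/-- The speed `|c'|`, so that `ds = |c'| dθ`. -/
def speed (c : Imm) (θ : ℝ) : ℝ := ‖deriv c.toLoop θ‖

theorem speed_pos (c : Imm) (θ : ℝ) : 0 < c.speed θ := norm_pos_iff.2 (c.2 θ)

theorem speed_contDiff (c : Imm) : ContDiff ℝ ∞ c.speed :=
  (contDiff_deriv (loop_contDiff c.toLoop)).norm ℝ c.2

theorem speed_periodic (c : Imm) : Function.Periodic c.speed (2 * Real.pi) := fun θ => by
  simp only [speed, periodic_deriv (loop_periodic c.toLoop) θ]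

/-- The arc-length derivative `D_s = |c'|⁻¹ ∂_θ` along `c`. -/
def Ds (c : Imm) : Module.End ℝ (Loop F) where
  toFun h := ⟨fun θ => (c.speed θ)⁻¹ • deriv h θ,
    (c.speed_contDiff.inv fun θ => (c.speed_pos θ).ne').smul (contDiff_deriv (loop_contDiff h)),
    fun θ => by simp only [c.speed_periodic θ, periodic_deriv (loop_periodic h) θ]⟩
  map_add' f g := Subtype.ext <| funext fun θ => by
    have hf : DifferentiableAt ℝ f θ := (loop_contDiff f).differentiable (by simp) θ
    have hg : DifferentiableAt ℝ g θ := (loop_contDiff g).differentiable (by simp) θ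
    change (c.speed θ)⁻¹ • deriv ((f : ℝ → F) + (g : ℝ → F)) θ
      = (c.speed θ)⁻¹ • deriv f θ + (c.speed θ)⁻¹ • deriv g θ
    rw [deriv_add hf hg, smul_add]
  map_smul' a f := Subtype.ext <| funext fun θ => by
    have hf : DifferentiableAt ℝ f θ := (loop_contDiff f).differentiable (by simp) θ
    change (c.speed θ)⁻¹ • deriv (a • (f : ℝ → F)) θ = a • ((c.speed θ)⁻¹ • deriv f θ)
    rw [deriv_const_smul a hf, smul_comm]

/-- The unit tangent vector `v = D_s c`. -/
def tangent (c : Imm) : Loop Plane := c.Ds c.toLoop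

end Imm

/-- The rotation `J` of the plane by `π / 2`. -/
def rot (x : Plane) : Plane := !₂[-x 1, x 0]

theorem contDiff_rot : ContDiff ℝ ∞ rot := by
  rw [contDiff_euclidean]
  intro i
  fin_cases i
  · simpa [rot] using (contDiff_euclidean.1 (contDiff_id (𝕜 := ℝ) (E := Plane)) 1).neg
  · simpa [rot] using contDiff_euclidean.1 (contDiff_id (𝕜 := ℝ) (E := Plane)) 0

namespace Imm

/-- The curvature `κ = ⟨D_s v, n⟩`, where `n = J v` is the unit normal vector. -/
def curvature (c : Imm) : Loop ℝ :=
  ⟨fun θ => ⟪c.Ds c.tangent θ, rot (c.tangent θ)⟫,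
    (loop_contDiff (c.Ds c.tangent)).inner ℝ (contDiff_rot.comp (loop_contDiff c.tangent)),
    fun θ => by simp only [loop_periodic (c.Ds c.tangent) θ, loop_periodic c.tangent θ]⟩

/-- The function `log |c'|`. -/
def logSpeed (c : Imm) : Loop ℝ :=
  ⟨fun θ => Real.log (c.speed θ), c.speed_contDiff.log fun θ => (c.speed_pos θ).ne',
    fun θ => by simp only [c.speed_periodic θ]⟩

end Imm

/-- `L²(S¹, ℝ)` with respect to `dθ`. -/
abbrev L2Circle : Type := Lp ℝ 2 (volume.restrict (Set.Ioc 0 (2 * Real.pi)))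

theorem memLp_mul_sqrt_speed (c : Imm) (f : Loop ℝ) :
    MemLp (fun θ => f θ * √(c.speed θ)) 2 (volume.restrict (Set.Ioc 0 (2 * Real.pi))) := by
  have hc : Continuous fun θ => f θ * √(c.speed θ) :=
    (loop_contDiff f).continuous.mul c.speed_contDiff.continuous.sqrt
  obtain ⟨C, hC⟩ := (isCompact_Icc (a := (0 : ℝ)) (b := 2 * Real.pi)).exists_bound_of_continuousOn
    hc.continuousOn
  refine MemLp.of_bound hc.aestronglyMeasurable C ?_
  filter_upwards [ae_restrict_mem measurableSet_Ioc] with θ hθ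
  exact hC θ ⟨hθ.1.le, hθ.2⟩

/-- The element `f √|c'|` of `L²(S¹, ℝ)`. -/
def weightedL2 (c : Imm) (f : Loop ℝ) : L2Circle := (memLp_mul_sqrt_speed c f).toLp _

/-- The map `c ↦ (D_s^k κ) √|c'|` from `Imm(S¹, ℝ²)` to `L²(S¹, ℝ)`. -/
def curvatureMap (k : ℕ) (c : Imm) : L2Circle := weightedL2 c ((c.Ds ^ k) c.curvature)

/-- The map `c ↦ (D_s^{k+1} log |c'|) √|c'|` from `Imm(S¹, ℝ²)` to `L²(S¹, ℝ)`. -/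
def logSpeedMap (k : ℕ) (c : Imm) : L2Circle := weightedL2 c ((c.Ds ^ (k + 1)) c.logSpeed)

/-- Smooth curves `ℝ → C^∞(S¹, F)`: by the exponential law these are the maps `t ↦ γ(t, ·)` with
`γ` jointly smooth in `(t, θ)`. -/
def IsSmoothCurve (γ : ℝ → Loop F) : Prop := ContDiff ℝ ∞ fun p : ℝ × ℝ => γ p.1 p.2

theorem contDiff_partial_left {E : Type*} [NormedAddCommGroup E] [NormedSpace ℝ E]
    {f : ℝ × ℝ → E} (hf : ContDiff ℝ ∞ f) :
    ContDiff ℝ ∞ fun p : ℝ × ℝ => deriv (fun t => f (t, p.2)) p.1 := by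
  have h1 : ∀ p : ℝ × ℝ, deriv (fun t => f (t, p.2)) p.1 = fderiv ℝ f p (1, 0) := fun p =>
    ((hf.differentiable (by simp) p).hasFDerivAt.comp_hasDerivAt p.1
      ((hasDerivAt_id p.1).prodMk (hasDerivAt_const p.1 p.2))).deriv
  simp only [h1]
  exact (hf.fderiv_right (m := ∞) (by simp)).clm_apply contDiff_const

theorem contDiff_partial_right {E : Type*} [NormedAddCommGroup E] [NormedSpace ℝ E]
    {f : ℝ × ℝ → E} (hf : ContDiff ℝ ∞ f) :
    ContDiff ℝ ∞ fun p : ℝ × ℝ => deriv (fun θ => f (p.1, θ)) p.2 := by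
  have h1 : ∀ p : ℝ × ℝ, deriv (fun θ => f (p.1, θ)) p.2 = fderiv ℝ f p (0, 1) := fun p =>
    ((hf.differentiable (by simp) p).hasFDerivAt.comp_hasDerivAt p.2
      ((hasDerivAt_const p.2 p.1).prodMk (hasDerivAt_id p.2))).deriv
  simp only [h1]
  exact (hf.fderiv_right (m := ∞) (by simp)).clm_apply contDiff_const

/-- The velocity `∂_t γ(t, ·)` of a smooth curve in `C^∞(S¹, F)`. -/
def velocity (γ : ℝ → Loop F) (hγ : IsSmoothCurve γ) (t : ℝ) : Loop F :=
  ⟨fun θ => deriv (fun τ => γ τ θ) t,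
   (contDiff_partial_left hγ).comp (contDiff_const.prodMk contDiff_id),
   fun θ => by
    have : (fun τ => γ τ (θ + 2 * Real.pi)) = fun τ => γ τ θ :=
      funext fun τ => loop_periodic (γ τ) θ
    simp only [this]⟩

end Basic

/-- A (weak) Riemannian metric on `Imm(S¹, ℝ²)`, an open subset of the Fréchet space
`C^∞(S¹, ℝ²)`, with tangent spaces `T_c Imm = C^∞(S¹, ℝ²)`. Smoothness is in the sense of
convenient calculus (equivalently, of Fréchet spaces): smooth curves are mapped to smooth curves. -/
structure RiemannianMetric where
  /-- The bilinear form `G_c(h, k)`. -/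
  form : Imm → Loop Plane →ₗ[ℝ] Loop Plane →ₗ[ℝ] ℝ
  symm : ∀ c h k, form c h k = form c k h
  pos : ∀ c h, h ≠ 0 → 0 < form c h h
  smooth : ∀ (c : ℝ → Imm) (h k : ℝ → Loop Plane), IsSmoothCurve (fun t => (c t).toLoop) →
    IsSmoothCurve h → IsSmoothCurve k → ContDiff ℝ ∞ fun t => form (c t) (h t) (k t)

/-- The length `∫₀¹ √(G_γ(γ_t, γ_t)) dt` of the path `γ|_[0,1]` in `Imm(S¹, ℝ²)`. -/
def pathLength (G : RiemannianMetric) (γ : ℝ → Imm) (hγ : IsSmoothCurve fun t => (γ t).toLoop) :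
    ℝ≥0∞ :=
  ∫⁻ t in Set.Icc (0 : ℝ) 1,
    ENNReal.ofReal (√(G.form (γ t) (velocity _ hγ t) (velocity _ hγ t)))

/-- The geodesic distance: the infimum of the lengths of smooth paths in `Imm(S¹, ℝ²)` from `c₁` to
`c₂`. It is `∞` if there is no such path. (It makes no difference that paths are parametrized by
`ℝ` and restricted to `[0, 1]`: a smooth path on `[0, 1]` extends constantly to `ℝ` after a
monotone reparametrization which is flat at the end points, and this preserves its length.) -/
def geodesicDist (G : RiemannianMetric) (c₁ c₂ : Imm) : ℝ≥0∞ :=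
  ⨅ (γ : ℝ → Imm) (hγ : IsSmoothCurve fun t => (γ t).toLoop) (_ : γ 0 = c₁) (_ : γ 1 = c₂),
    pathLength G γ hγ

/-- Continuity of a map on `Imm(S¹, ℝ²)` with the geodesic distance of `G`. -/
def GeodesicContinuous (G : RiemannianMetric) (Φ : Imm → L2Circle) : Prop :=
  ∀ c₀ : Imm, ∀ ε : ℝ≥0∞, 0 < ε → ∃ δ : ℝ≥0∞, 0 < δ ∧
    ∀ c : Imm, geodesicDist G c₀ c < δ → edist (Φ c₀) (Φ c) < ε

/-- For `0 ≤ k ≤ n - 2`, the maps `c ↦ (D_s^k κ) √|c'|` and `c ↦ (D_s^{k+1} log |c'|) √|c'|` from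
`Imm(S¹, ℝ²)` with the geodesic distance of `G` to `L²(S¹, ℝ)` are Lipschitz on every metric ball,
with a constant that does not depend on `k`, and they are continuous. -/
def LipschitzOnMetricBalls (G : RiemannianMetric) (n : ℕ) : Prop :=
  (∀ (c₀ : Imm) (N : ℝ≥0), 0 < N → ∃ C : ℝ≥0, ∀ c₁ c₂ : Imm,
    geodesicDist G c₀ c₁ < N → geodesicDist G c₀ c₂ < N → ∀ k : ℕ, k + 2 ≤ n →
      edist (curvatureMap k c₁) (curvatureMap k c₂) ≤ C * geodesicDist G c₁ c₂ ∧
      edist (logSpeedMap k c₁) (logSpeedMap k c₂) ≤ C * geodesicDist G c₁ c₂) ∧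
  ∀ k : ℕ, k + 2 ≤ n →
    GeodesicContinuous G (curvatureMap k) ∧ GeodesicContinuous G (logSpeedMap k)

/-! ### Sobolev-type metrics with constant coefficients -/

theorem contDiff_parametric_integral {f : ℝ × ℝ → ℝ} (hf : ContDiff ℝ ∞ f) (a b : ℝ) :
    ContDiff ℝ ∞ fun t => ∫ θ in a..b, f (t, θ) := by
  have key : ∀ g : ℝ × ℝ → ℝ, ContDiff ℝ ∞ g → ∀ t, HasDerivAt (fun t => ∫ θ in a..b, g (t, θ))
      (∫ θ in a..b, deriv (fun t => g (t, θ)) t) t := by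
    intro g hg t
    have hd := contDiff_partial_left hg
    obtain ⟨C, hC⟩ := ((isCompact_closedBall t 1).prod
      (isCompact_uIcc (a := a) (b := b))).exists_bound_of_continuousOn hd.continuous.continuousOn
    refine (intervalIntegral.hasDerivAt_integral_of_dominated_loc_of_deriv_le
      (F := fun t θ => g (t, θ)) (F' := fun t θ => deriv (fun t => g (t, θ)) t)
      (bound := fun _ => C) (Metric.closedBall_mem_nhds t one_pos) ?_ ?_ ?_ ?_ ?_ ?_).2
    · exact Filter.Eventually.of_forall fun x =>
        (hg.continuous.comp (Continuous.prodMk_right x)).aestronglyMeasurable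
    · exact (hg.continuous.comp (Continuous.prodMk_right t)).intervalIntegrable a b
    · exact (hd.continuous.comp (Continuous.prodMk_right t)).aestronglyMeasurable
    · exact Filter.Eventually.of_forall fun θ hθ x hx =>
        hC (x, θ) ⟨hx, Set.uIoc_subset_uIcc hθ⟩
    · exact intervalIntegrable_const
    · exact Filter.Eventually.of_forall fun θ _ x _ =>
        ((hg.comp (contDiff_id.prodMk contDiff_const)).differentiable (by simp) x).hasDerivAt
  have all : ∀ m : ℕ, ∀ g : ℝ × ℝ → ℝ, ContDiff ℝ ∞ g →
      ContDiff ℝ m fun t => ∫ θ in a..b, g (t, θ) := by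
    intro m
    induction m with
    | zero =>
      intro g hg
      exact contDiff_zero.2 (continuous_iff_continuousAt.2 fun t => (key g hg t).continuousAt)
    | succ m ih =>
      intro g hg
      have hder : deriv (fun t => ∫ θ in a..b, g (t, θ))
          = fun t => ∫ θ in a..b, deriv (fun t => g (t, θ)) t := funext fun t => (key g hg t).deriv
      push_cast
      refine contDiff_succ_iff_deriv.2 ⟨fun t => (key g hg t).differentiableAt, by simp, ?_⟩
      rw [hder]
      exact ih (fun p => deriv (fun t => g (t, p.2)) p.1) (contDiff_partial_left hg)
  exact contDiff_infty.2 fun m => all m f hf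

theorem isSmoothCurve_Ds {F : Type*} [NormedAddCommGroup F] [NormedSpace ℝ F] {c : ℝ → Imm}
    (hc : IsSmoothCurve fun t => (c t).toLoop) {h : ℝ → Loop F} (hh : IsSmoothCurve h) :
    IsSmoothCurve fun t => (c t).Ds (h t) :=
  (((contDiff_partial_right hc).norm ℝ fun p => (c p.1).2 p.2).inv
    fun p => ((c p.1).speed_pos p.2).ne').smul (contDiff_partial_right hh)

theorem isSmoothCurve_Ds_pow {F : Type*} [NormedAddCommGroup F] [NormedSpace ℝ F] {c : ℝ → Imm}
    (hc : IsSmoothCurve fun t => (c t).toLoop) {h : ℝ → Loop F} (hh : IsSmoothCurve h) (j : ℕ) :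
    IsSmoothCurve fun t => ((c t).Ds ^ j) (h t) := by
  induction j with
  | zero => simpa using hh
  | succ j ih => simpa only [pow_succ', Module.End.mul_apply] using isSmoothCurve_Ds hc ih

/-- The integrand `∑_{j ≤ n} a_j ⟨D_s^j h, D_s^j k⟩ |c'|` with respect to `dθ`. -/
def sobolevIntegrand (n : ℕ) (a : ℕ → ℝ) (c : Imm) (h k : Loop Plane) (θ : ℝ) : ℝ :=
  (∑ j ∈ Finset.range (n + 1), a j * ⟪(c.Ds ^ j) h θ, (c.Ds ^ j) k θ⟫) * c.speed θ

theorem sobolevIntegrand_continuous (n : ℕ) (a : ℕ → ℝ) (c : Imm) (h k : Loop Plane) :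
    Continuous (sobolevIntegrand n a c h k) :=
  (continuous_finsetSum _ fun j _ => continuous_const.mul
    ((loop_contDiff ((c.Ds ^ j) h)).continuous.inner
      (loop_contDiff ((c.Ds ^ j) k)).continuous)).mul c.speed_contDiff.continuous

/-- The Sobolev-type metric `G_c(h, k) = ∫ ∑_{j ≤ n} a_j ⟨D_s^j h, D_s^j k⟩ ds` of order `n`, with
constant coefficients `a_j ≥ 0`, `a_0 ≠ 0`, `a_n ≠ 0`. -/
def sobolevMetric (n : ℕ) (a : ℕ → ℝ) (ha : ∀ j ≤ n, 0 ≤ a j) (ha0 : a 0 ≠ 0) (_han : a n ≠ 0) :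
    RiemannianMetric where
  form c := LinearMap.mk₂ ℝ (fun h k => ∫ θ in (0 : ℝ)..2 * Real.pi, sobolevIntegrand n a c h k θ)
    (fun h₁ h₂ k => by
      rw [← intervalIntegral.integral_add
        ((sobolevIntegrand_continuous n a c h₁ k).intervalIntegrable _ _)
        ((sobolevIntegrand_continuous n a c h₂ k).intervalIntegrable _ _)]
      simp only [sobolevIntegrand, map_add, Submodule.coe_add, Pi.add_apply, inner_add_left,
        mul_add, Finset.sum_add_distrib, add_mul])
    (fun r h k => by
      rw [smul_eq_mul, ← intervalIntegral.integral_const_mul]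
      simp only [sobolevIntegrand, map_smul, Submodule.coe_smul, Pi.smul_apply,
        real_inner_smul_left, Finset.sum_mul, Finset.mul_sum]
      exact intervalIntegral.integral_congr fun θ _ =>
        Finset.sum_congr rfl fun j _ => by ring)
    (fun h k₁ k₂ => by
      rw [← intervalIntegral.integral_add
        ((sobolevIntegrand_continuous n a c h k₁).intervalIntegrable _ _)
        ((sobolevIntegrand_continuous n a c h k₂).intervalIntegrable _ _)]
      simp only [sobolevIntegrand, map_add, Submodule.coe_add, Pi.add_apply, inner_add_right,
        mul_add, Finset.sum_add_distrib, add_mul])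
    (fun r h k => by
      rw [smul_eq_mul, ← intervalIntegral.integral_const_mul]
      simp only [sobolevIntegrand, map_smul, Submodule.coe_smul, Pi.smul_apply,
        real_inner_smul_right, Finset.sum_mul, Finset.mul_sum]
      exact intervalIntegral.integral_congr fun θ _ =>
        Finset.sum_congr rfl fun j _ => by ring)
  symm c h k := by
    simp only [LinearMap.mk₂_apply, sobolevIntegrand, real_inner_comm]
  pos c h hh := by
    rw [LinearMap.mk₂_apply]
    have ha0' : 0 < a 0 := lt_of_le_of_ne (ha 0 (Nat.zero_le n)) ha0.symm
    have hterm : ∀ θ, ∀ j ∈ Finset.range (n + 1),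
        0 ≤ a j * ⟪(c.Ds ^ j) h θ, (c.Ds ^ j) h θ⟫ := fun θ j hj =>
      mul_nonneg (ha j (Nat.lt_succ_iff.1 (Finset.mem_range.1 hj))) real_inner_self_nonneg
    obtain ⟨θ₀, hθ₀⟩ : ∃ θ, h θ ≠ 0 := by
      by_contra hcon
      push Not at hcon
      exact hh (Subtype.ext (funext hcon))
    obtain ⟨θ, hθ, hθ'⟩ := (loop_periodic h).exists_mem_Ico₀ Real.two_pi_pos θ₀
    refine intervalIntegral.integral_pos Real.two_pi_pos
      (sobolevIntegrand_continuous n a c h h).continuousOn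
      (fun x _ => mul_nonneg (Finset.sum_nonneg (hterm x)) (c.speed_pos x).le)
      ⟨θ, ⟨hθ.1, hθ.2.le⟩, mul_pos (Finset.sum_pos' (hterm θ) ⟨0, by simp, ?_⟩) (c.speed_pos θ)⟩
    rw [pow_zero, Module.End.one_apply]
    exact mul_pos ha0' (real_inner_self_pos.2 (hθ' ▸ hθ₀))
  smooth c h k hc hh hk := by
    refine contDiff_parametric_integral (f := fun p => sobolevIntegrand n a (c p.1) (h p.1) (k p.1)
      p.2) ?_ _ _
    refine ContDiff.mul (ContDiff.sum fun j _ => contDiff_const.mul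
      ((isSmoothCurve_Ds_pow hc hh j).inner ℝ (isSmoothCurve_Ds_pow hc hk j))) ?_
    exact (contDiff_partial_right hc).norm ℝ fun p => (c p.1).2 p.2

end PlaneCurves

end

open MeasureTheory
open scoped ContDiff ENNReal NNReal RealInnerProductSpace

noncomputable section

namespace PlaneCurves

/-! ### Calculus of `D_s` on loops -/

section Loops

variable {F : Type*} [NormedAddCommGroup F] [NormedSpace ℝ F]

/-! Along a path of curves with velocity h, write a = ⟨D_s h, v⟩ and b = ⟨D_s h, n⟩. Then ∂_t
log|c'| = a, ∂_t κ = D_s b - aκ and [∂_t, D_s] = -a D_s. So y_k = D_s^{k+1} log|c'| and κ_k = D_s^k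
κ evolve in the same way: a leading term, D_s^{k+1} a or D_s^{k+1} b, minus commutator terms D_s^j(a
y_{k-j}) or D_s^j(a κ_{k-j}) with j ≤ k. If the y_i and κ_i with i < k are bounded, the Leibniz rule
gives the pointwise estimate |∂_t y_k|, |∂_t κ_k| ≤ C (∑_{1 ≤ i ≤ k+2} |D_s^i h| + |D_s h| (|y_k| +
|κ_k|)), which is affine in the unknowns of top order (`exists_abs_velocity_le`).

The metric controls h. Integration by parts bounds the L²(ds) norms of D_s^j h for j ≤ n by the
metric speed (`Imm.normSq_Ds_pow_le`). A Rolle argument bounds the sup norms for 1 ≤ j ≤ n-1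
(`Imm.norm_Ds_pow_sq_le`), with a constant depending on the length of the curve, which itself grows
at most exponentially in the length of the path (`Coercive.len_le`). For k ≤ n-3 the sum above is
thus bounded in θ, and a Gronwall argument at each θ bounds y_k and κ_k by induction on k. For k =
n-2 the derivative D_s^n h is only in L², and Gronwall is applied to the L²(ds) norms instead. These
bounds hold along all paths of bounded length, hence on metric balls (`Coercive.exists_shapeBound`).

Finally ∂_t (f √|c'|) = (∂_t f + a f / 2) √|c'|, whose L²(dθ) norm for f = y_k or κ_k is at most a
constant times the metric speed; integrating in t gives the Lipschitz estimate along the path. A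
path joining two points of a ball may leave it. If its length is at most 1, the bounds still
propagate along it; if it is longer, boundedness of both maps on the ball already suffices. -/

theorem loop_continuous (f : Loop F) : Continuous (f : ℝ → F) := (loop_contDiff f).continuous

theorem loop_differentiable (f : Loop F) : Differentiable ℝ (f : ℝ → F) :=
  (loop_contDiff f).differentiable (by simp)

theorem loop_ext {f g : Loop F} (h : ∀ θ, f θ = g θ) : f = g := Subtype.ext (funext h)

/-- The pointwise product of a scalar loop and a loop. -/
def smulLoop (f : Loop ℝ) (g : Loop F) : Loop F :=
  ⟨fun θ => f θ • g θ, (loop_contDiff f).smul (loop_contDiff g), fun θ => by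
    simp only [loop_periodic f θ, loop_periodic g θ]⟩

@[simp] theorem smulLoop_apply (f : Loop ℝ) (g : Loop F) (θ : ℝ) :
    smulLoop f g θ = f θ • g θ := rfl

/-- The pointwise inner product of two loops in the plane. -/
def innerLoop (f g : Loop Plane) : Loop ℝ :=
  ⟨fun θ => ⟪f θ, g θ⟫, (loop_contDiff f).inner ℝ (loop_contDiff g), fun θ => by
    simp only [loop_periodic f θ, loop_periodic g θ]⟩

@[simp] theorem innerLoop_apply (f g : Loop Plane) (θ : ℝ) : innerLoop f g θ = ⟪f θ, g θ⟫ := rfl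

/-- The pointwise rotation of a loop in the plane. -/
def rotLoop (f : Loop Plane) : Loop Plane :=
  ⟨fun θ => rot (f θ), contDiff_rot.comp (loop_contDiff f), fun θ => by
    simp only [loop_periodic f θ]⟩

@[simp] theorem rotLoop_apply (f : Loop Plane) (θ : ℝ) : rotLoop f θ = rot (f θ) := rfl

@[simp] theorem loop_add_apply (f g : Loop F) (θ : ℝ) : (f + g : Loop F) θ = f θ + g θ := rfl

@[simp] theorem loop_sub_apply (f g : Loop F) (θ : ℝ) : (f - g : Loop F) θ = f θ - g θ := rfl

theorem loop_sum_apply {ι : Type*} (s : Finset ι) (f : ι → Loop F) (θ : ℝ) :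
    (∑ i ∈ s, f i : Loop F) θ = ∑ i ∈ s, f i θ := by
  rw [Submodule.coe_sum, Finset.sum_apply]

namespace Imm

variable (c : Imm)

theorem hasDerivAt_loop (f : Loop F) (θ : ℝ) : HasDerivAt f (c.speed θ • c.Ds f θ) θ := by
  have h := (loop_differentiable f θ).hasDerivAt
  have e : c.speed θ • c.Ds f θ = deriv f θ := by
    change c.speed θ • ((c.speed θ)⁻¹ • deriv f θ) = _
    rw [smul_inv_smul₀ (c.speed_pos θ).ne']
  rwa [e]

theorem Ds_eq_of_hasDerivAt {f : Loop F} {θ : ℝ} {x : F} (h : HasDerivAt f (c.speed θ • x) θ) :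
    c.Ds f θ = x := by
  have := (c.hasDerivAt_loop f θ).unique h
  exact smul_right_injective F (c.speed_pos θ).ne' this

theorem Ds_smulLoop (f : Loop ℝ) (g : Loop F) :
    c.Ds (smulLoop f g) = smulLoop (c.Ds f) g + smulLoop f (c.Ds g) := by
  refine loop_ext fun θ => c.Ds_eq_of_hasDerivAt ?_
  refine ((c.hasDerivAt_loop f θ).smul (c.hasDerivAt_loop g θ)).congr_deriv ?_
  simp only [loop_add_apply, smulLoop_apply, smul_add, smul_smul, smul_eq_mul]
  rw [mul_comm (f θ), add_comm]

theorem Ds_innerLoop (f g : Loop Plane) :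
    c.Ds (innerLoop f g) = innerLoop (c.Ds f) g + innerLoop f (c.Ds g) := by
  refine loop_ext fun θ => c.Ds_eq_of_hasDerivAt ?_
  refine ((c.hasDerivAt_loop f θ).inner ℝ (c.hasDerivAt_loop g θ)).congr_deriv ?_
  simp only [loop_add_apply, innerLoop_apply, real_inner_smul_left, real_inner_smul_right,
    smul_eq_mul]
  ring

/-- A Leibniz estimate: each differentiation doubles the number of terms, whence 2 ^ m. Bounding
products rather than factors allows one factor to be of uncontrolled top order. -/
theorem abs_Ds_pow_smulLoop_le (m : ℕ) (f g : Loop ℝ) (θ R : ℝ)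
    (h : ∀ i j, i + j = m → |(c.Ds ^ i) f θ| * |(c.Ds ^ j) g θ| ≤ R) :
    |(c.Ds ^ m) (smulLoop f g) θ| ≤ 2 ^ m * R := by
  induction m generalizing f g with
  | zero => simpa [abs_mul] using h 0 0 rfl
  | succ m ih =>
    have h₁ := ih (c.Ds f) g fun i j hij => by
      simpa only [pow_succ, Module.End.mul_apply] using h (i + 1) j (by omega)
    have h₂ := ih f (c.Ds g) fun i j hij => by
      simpa only [pow_succ, Module.End.mul_apply] using h i (j + 1) (by omega)
    rw [pow_succ, Module.End.mul_apply, Ds_smulLoop, map_add, loop_add_apply, pow_succ]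
    linarith [abs_add_le ((c.Ds ^ m) (smulLoop (c.Ds f) g) θ) ((c.Ds ^ m) (smulLoop f (c.Ds g)) θ)]

end Imm

end Loops

/-! ### The moving frame -/

/-- The rotation by `π / 2` as a continuous linear map. -/
def rotCLM : Plane →L[ℝ] Plane := LinearMap.toContinuousLinearMap
  { toFun := rot
    map_add' := fun x y => by
      ext i
      fin_cases i
      · simp [rot]; ring
      · simp [rot]
    map_smul' := fun r x => by
      ext i
      fin_cases i <;> simp [rot] }

theorem rotCLM_apply (x : Plane) : rotCLM x = rot x := rfl

theorem inner_plane (x y : Plane) : ⟪x, y⟫ = x 0 * y 0 + x 1 * y 1 := by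
  simp [PiLp.inner_apply, Fin.sum_univ_two]
  ring

@[simp] theorem rot_zero_apply (x : Plane) : rot x 0 = -x 1 := rfl

@[simp] theorem rot_one_apply (x : Plane) : rot x 1 = x 0 := rfl

theorem inner_rot_rot (x y : Plane) : ⟪rot x, rot y⟫ = ⟪x, y⟫ := by
  simp only [inner_plane, rot_zero_apply, rot_one_apply]; ring

theorem inner_rot_self (x : Plane) : ⟪x, rot x⟫ = 0 := by
  simp only [inner_plane, rot_zero_apply, rot_one_apply]; ring

theorem rot_rot (x : Plane) : rot (rot x) = -x := by
  ext i
  fin_cases i <;> simp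

theorem norm_rot (x : Plane) : ‖rot x‖ = ‖x‖ := by
  rw [← sq_eq_sq₀ (norm_nonneg _) (norm_nonneg _), ← real_inner_self_eq_norm_sq,
    ← real_inner_self_eq_norm_sq, inner_rot_rot]

theorem frame_decomposition {v : Plane} (hv : ‖v‖ = 1) (x : Plane) :
    x = ⟪x, v⟫ • v + ⟪x, rot v⟫ • rot v := by
  have h1 : v 0 * v 0 + v 1 * v 1 = 1 := by
    rw [← inner_plane, real_inner_self_eq_norm_sq, hv, one_pow]
  ext i
  fin_cases i
  · simp only [inner_plane, rot_zero_apply, rot_one_apply, Fin.zero_eta, PiLp.add_apply,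
      PiLp.smul_apply, smul_eq_mul]
    linear_combination (-x 0) * h1
  · simp only [inner_plane, rot_zero_apply, rot_one_apply, Fin.mk_one, PiLp.add_apply,
      PiLp.smul_apply, smul_eq_mul]
    linear_combination (-x 1) * h1

namespace Imm

variable (c : Imm)

theorem Ds_rotLoop (f : Loop Plane) : c.Ds (rotLoop f) = rotLoop (c.Ds f) := by
  refine loop_ext fun θ => c.Ds_eq_of_hasDerivAt ?_
  refine (rotCLM.hasFDerivAt.comp_hasDerivAt θ (c.hasDerivAt_loop f θ)).congr_deriv ?_
  rw [map_smul]
  rfl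

theorem norm_tangent (θ : ℝ) : ‖c.tangent θ‖ = 1 := by
  change ‖(c.speed θ)⁻¹ • deriv c.toLoop θ‖ = 1
  rw [norm_smul, norm_inv, Real.norm_eq_abs, abs_of_pos (c.speed_pos θ)]
  exact inv_mul_cancel₀ (c.speed_pos θ).ne'

theorem inner_Ds_tangent (θ : ℝ) : ⟪c.Ds c.tangent θ, c.tangent θ⟫ = 0 := by
  have h0 : c.Ds (innerLoop c.tangent c.tangent) θ = 0 := by
    refine c.Ds_eq_of_hasDerivAt ?_
    have : ((innerLoop c.tangent c.tangent : Loop ℝ) : ℝ → ℝ) = fun _ => 1 := funext fun x => by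
      rw [innerLoop_apply, real_inner_self_eq_norm_sq, norm_tangent, one_pow]
    rw [this, smul_zero]
    exact hasDerivAt_const _ _
  rw [Ds_innerLoop, loop_add_apply, innerLoop_apply, innerLoop_apply,
    real_inner_comm (c.Ds c.tangent θ) (c.tangent θ)] at h0
  linarith

/-- The Frenet equation: since |v| = 1, the derivative of v has no tangential component. -/
theorem Ds_tangent : c.Ds c.tangent = smulLoop c.curvature (rotLoop c.tangent) := by
  refine loop_ext fun θ => ?_
  conv_lhs => rw [frame_decomposition (c.norm_tangent θ) (c.Ds c.tangent θ)]
  rw [inner_Ds_tangent, zero_smul, zero_add]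
  rfl

/-- The tangential part of a vector field along `c`. -/
def tangentialPart (h : Loop Plane) : Loop ℝ := innerLoop h c.tangent

/-- The normal part of a vector field along `c`. -/
def normalPart (h : Loop Plane) : Loop ℝ := innerLoop h (rotLoop c.tangent)

theorem abs_tangentialPart_le (h : Loop Plane) (θ : ℝ) : |c.tangentialPart h θ| ≤ ‖h θ‖ := by
  simpa [tangentialPart, norm_tangent] using abs_real_inner_le_norm (h θ) (c.tangent θ)

theorem abs_normalPart_le (h : Loop Plane) (θ : ℝ) : |c.normalPart h θ| ≤ ‖h θ‖ := by
  simpa [normalPart, norm_rot, norm_tangent] using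
    abs_real_inner_le_norm (h θ) (rot (c.tangent θ))

/-- By the Frenet equation, differentiating the frame costs only a factor κ and exchanges the two
parts. This keeps derivatives of v out of all later estimates. -/
theorem Ds_tangentialPart (h : Loop Plane) : c.Ds (c.tangentialPart h) =
    c.tangentialPart (c.Ds h) + smulLoop c.curvature (c.normalPart h) := by
  rw [tangentialPart, Ds_innerLoop, Ds_tangent]
  refine loop_ext fun θ => ?_
  simp [tangentialPart, normalPart, real_inner_smul_right]

theorem Ds_normalPart (h : Loop Plane) : c.Ds (c.normalPart h) =
    c.normalPart (c.Ds h) - smulLoop c.curvature (c.tangentialPart h) := by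
  rw [normalPart, Ds_innerLoop, Ds_rotLoop, Ds_tangent]
  refine loop_ext fun θ => ?_
  have : rot (c.curvature θ • rot (c.tangent θ)) = -(c.curvature θ • c.tangent θ) := by
    rw [← rotCLM_apply, map_smul, rotCLM_apply, rot_rot, smul_neg]
  simp [tangentialPart, normalPart, real_inner_smul_right, this, sub_eq_add_neg]

/-- The derivatives of the tangential and normal parts of `D_s^j h` are controlled by the
derivatives of `h`, as long as the lower derivatives of the curvature are bounded. -/
theorem exists_abs_Ds_pow_parts_le (B : ℝ) (hB : 0 ≤ B) (m : ℕ) : ∃ C : ℝ, 0 ≤ C ∧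
    ∀ (c : Imm) (h : Loop Plane) (θ : ℝ), (∀ i < m, |(c.Ds ^ i) c.curvature θ| ≤ B) →
      ∀ l ≤ m, ∀ j : ℕ,
        |(c.Ds ^ l) (c.tangentialPart ((c.Ds ^ j) h)) θ|
          ≤ C * ∑ i ∈ Finset.range (m + 1), ‖(c.Ds ^ (j + i)) h θ‖ ∧
        |(c.Ds ^ l) (c.normalPart ((c.Ds ^ j) h)) θ|
          ≤ C * ∑ i ∈ Finset.range (m + 1), ‖(c.Ds ^ (j + i)) h θ‖ := by
  induction m with
  | zero =>
    refine ⟨1, zero_le_one, fun c h θ _ l hl j => ?_⟩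
    obtain rfl : l = 0 := by omega
    simpa using ⟨c.abs_tangentialPart_le _ θ, c.abs_normalPart_le _ θ⟩
  | succ m ih =>
    obtain ⟨C, hC, ih⟩ := ih
    -- One derivative of a part of D_s^j h gives a part of D_s^{j+1} h, bounded by C * T thanks to
    -- the quantifier over j, plus κ times the other part of D_s^j h, whose m-th derivative costs 2
    -- ^ m * B * C * T.
    refine ⟨C * (1 + 2 ^ m * B), by positivity, fun c h θ hκ l hl j => ?_⟩
    have ih' := ih c h θ fun i hi => hκ i (by omega)
    set T : ℝ := ∑ i ∈ Finset.range (m + 1 + 1), ‖(c.Ds ^ (j + i)) h θ‖ with hT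
    have hT0 : 0 ≤ T := Finset.sum_nonneg fun _ _ => norm_nonneg _
    have e1 : ∑ i ∈ Finset.range (m + 1), ‖(c.Ds ^ (j + i)) h θ‖ ≤ T := by
      rw [hT, Finset.sum_range_succ _ (m + 1)]
      linarith [norm_nonneg ((c.Ds ^ (j + (m + 1))) h θ)]
    have e2 : ∑ i ∈ Finset.range (m + 1), ‖(c.Ds ^ (j + 1 + i)) h θ‖ ≤ T := by
      rw [hT, Finset.sum_range_succ' _ (m + 1)]
      have : ∀ i, j + 1 + i = j + (i + 1) := fun i => by ring
      simp only [this]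
      linarith [norm_nonneg ((c.Ds ^ (j + 0)) h θ)]
    have low : ∀ l ≤ m, |(c.Ds ^ l) (c.tangentialPart ((c.Ds ^ j) h)) θ| ≤ C * T ∧
        |(c.Ds ^ l) (c.normalPart ((c.Ds ^ j) h)) θ| ≤ C * T := fun l hl =>
      ⟨((ih' l hl j).1).trans (by gcongr), ((ih' l hl j).2).trans (by gcongr)⟩
    rcases Nat.lt_or_ge m l with hml | hml
    · obtain rfl : l = m + 1 := by omega
      have p1 : |(c.Ds ^ m) (c.tangentialPart ((c.Ds ^ (j + 1)) h)) θ| ≤ C * T :=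
        ((ih' m le_rfl (j + 1)).1).trans (by gcongr)
      have p2 : |(c.Ds ^ m) (c.normalPart ((c.Ds ^ (j + 1)) h)) θ| ≤ C * T :=
        ((ih' m le_rfl (j + 1)).2).trans (by gcongr)
      have q1 : |(c.Ds ^ m) (smulLoop c.curvature (c.normalPart ((c.Ds ^ j) h))) θ|
          ≤ 2 ^ m * (B * (C * T)) := c.abs_Ds_pow_smulLoop_le _ _ _ _ _ fun i l' hil =>
        mul_le_mul (hκ i (by omega)) (low l' (by omega)).2 (abs_nonneg _) hB
      have q2 : |(c.Ds ^ m) (smulLoop c.curvature (c.tangentialPart ((c.Ds ^ j) h))) θ|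
          ≤ 2 ^ m * (B * (C * T)) := c.abs_Ds_pow_smulLoop_le _ _ _ _ _ fun i l' hil =>
        mul_le_mul (hκ i (by omega)) (low l' (by omega)).1 (abs_nonneg _) hB
      have r : C * (1 + 2 ^ m * B) * T = C * T + 2 ^ m * (B * (C * T)) := by ring
      rw [r, pow_succ (c.Ds) m, Module.End.mul_apply, Module.End.mul_apply, Ds_tangentialPart,
        Ds_normalPart, map_add, map_sub, loop_add_apply, loop_sub_apply, ← Module.End.mul_apply,
        ← pow_succ']
      exact ⟨(abs_add_le _ _).trans (add_le_add p1 q1), (abs_sub _ _).trans (add_le_add p2 q2)⟩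
    · have r : C * T ≤ C * (1 + 2 ^ m * B) * T := by
        have : 0 ≤ C * T * (2 ^ m * B) := by positivity
        nlinarith
      exact ⟨(low l hml).1.trans r, (low l hml).2.trans r⟩

end Imm

/-! ### Time derivatives along a path of curves -/

section Velocity

variable {F : Type*} [NormedAddCommGroup F] [NormedSpace ℝ F]

theorem hasDerivAt_velocity {f : ℝ → Loop F} (hf : IsSmoothCurve f) (t θ : ℝ) :
    HasDerivAt (fun τ => f τ θ) (velocity f hf t θ) t := by
  have h1 : ContDiff ℝ ∞ fun τ => f τ θ :=
    ContDiff.comp (g := fun p : ℝ × ℝ => f p.1 p.2) hf (contDiff_id.prodMk contDiff_const)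
  exact (h1.differentiable (by simp) t).hasDerivAt

theorem velocity_eq_of_hasDerivAt {f : ℝ → Loop F} (hf : IsSmoothCurve f) {t θ : ℝ} {x : F}
    (h : HasDerivAt (fun τ => f τ θ) x t) : velocity f hf t θ = x :=
  (hasDerivAt_velocity hf t θ).unique h

theorem isSmoothCurve_velocity {f : ℝ → Loop F} (hf : IsSmoothCurve f) :
    IsSmoothCurve (velocity f hf) := contDiff_partial_left hf

/-- Partial derivatives of a smooth function of two variables commute. -/
theorem deriv_deriv_comm {f : ℝ × ℝ → F} (hf : ContDiff ℝ ∞ f) (t θ : ℝ) :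
    deriv (fun τ => deriv (fun x => f (τ, x)) θ) t =
      deriv (fun x => deriv (fun τ => f (τ, x)) t) θ := by
  have hd : ∀ p, HasFDerivAt f (fderiv ℝ f p) p := fun p =>
    (hf.differentiable (by simp) p).hasFDerivAt
  have hr : ∀ τ x, deriv (fun x => f (τ, x)) x = fderiv ℝ f (τ, x) (0, 1) := fun τ x =>
    ((hd (τ, x)).comp_hasDerivAt x ((hasDerivAt_const x τ).prodMk (hasDerivAt_id x))).deriv
  have hl : ∀ τ x, deriv (fun τ => f (τ, x)) τ = fderiv ℝ f (τ, x) (1, 0) := fun τ x =>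
    ((hd (τ, x)).comp_hasDerivAt τ ((hasDerivAt_id τ).prodMk (hasDerivAt_const τ x))).deriv
  simp only [hr, hl]
  have h2 : HasFDerivAt (fderiv ℝ f) (fderiv ℝ (fderiv ℝ f) (t, θ)) (t, θ) :=
    ((hf.fderiv_right (m := ∞) (by simp)).differentiable (by simp) _).hasFDerivAt
  have e1 : HasDerivAt (fun τ => fderiv ℝ f (τ, θ)) (fderiv ℝ (fderiv ℝ f) (t, θ) (1, 0)) t :=
    h2.comp_hasDerivAt t ((hasDerivAt_id t).prodMk (hasDerivAt_const t θ))
  have e2 : HasDerivAt (fun x => fderiv ℝ f (t, x)) (fderiv ℝ (fderiv ℝ f) (t, θ) (0, 1)) θ :=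
    h2.comp_hasDerivAt θ ((hasDerivAt_const θ t).prodMk (hasDerivAt_id θ))
  have e1' := e1.clm_apply (hasDerivAt_const t ((0 : ℝ), (1 : ℝ)))
  have e2' := e2.clm_apply (hasDerivAt_const θ ((1 : ℝ), (0 : ℝ)))
  rw [e1'.deriv, e2'.deriv, map_zero, add_zero, add_zero]
  exact second_derivative_symmetric hd h2 _ _

end Velocity

section Path

variable {F : Type*} [NormedAddCommGroup F] [NormedSpace ℝ F]
variable {γ : ℝ → Imm}

/-- `⟨D_s h, v⟩`, where `h` is the velocity of the path `γ`. -/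
def stretch (hγ : IsSmoothCurve fun t => (γ t).toLoop) (t : ℝ) : Loop ℝ := (γ t).tangentialPart ((γ t).Ds (velocity _ hγ t))

/-- `⟨D_s h, n⟩`, where `h` is the velocity of the path `γ`. -/
def turning (hγ : IsSmoothCurve fun t => (γ t).toLoop) (t : ℝ) : Loop ℝ := (γ t).normalPart ((γ t).Ds (velocity _ hγ t))

theorem hasDerivAt_deriv_velocity {f : ℝ → Loop F} (hf : IsSmoothCurve f) (t θ : ℝ) :
    HasDerivAt (fun τ => deriv (f τ) θ) (deriv (velocity f hf t) θ) t := by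
  have h := contDiff_partial_right hf
  have h1 : ContDiff ℝ ∞ fun τ => deriv (f τ) θ :=
    ContDiff.comp (g := fun p : ℝ × ℝ => deriv (f p.1) p.2) h (contDiff_id.prodMk contDiff_const)
  have h2 := (h1.differentiable (by simp) t).hasDerivAt
  have h3 := deriv_deriv_comm hf t θ
  exact h2.congr_deriv h3

theorem deriv_toLoop (c : Imm) (θ : ℝ) : deriv c.toLoop θ = c.speed θ • c.tangent θ :=
  (c.hasDerivAt_loop c.toLoop θ).deriv

/-- Differentiate √(|c'|²), using ∂_t c' = |c'| D_s h and c' = |c'| v. -/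
theorem hasDerivAt_speed (hγ : IsSmoothCurve fun t => (γ t).toLoop) (t θ : ℝ) :
    HasDerivAt (fun τ => (γ τ).speed θ) ((γ t).speed θ * stretch hγ t θ) t := by
  have h1 := hasDerivAt_deriv_velocity hγ t θ
  have h2 := (h1.norm_sq).sqrt (by
    have := (γ t).speed_pos θ
    simp only [Imm.speed] at this
    positivity)
  have e : (fun τ => √(‖deriv (γ τ).toLoop θ‖ ^ 2)) = fun τ => (γ τ).speed θ := funext fun τ => by
    rw [Real.sqrt_sq (norm_nonneg _)]; rfl
  have e' : √(‖deriv (γ t).toLoop θ‖ ^ 2) = (γ t).speed θ := congrFun e t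
  rw [e, e'] at h2
  refine h2.congr_deriv ?_
  have hs := (γ t).speed_pos θ
  rw [deriv_toLoop, ((γ t).hasDerivAt_loop (velocity _ hγ t) θ).deriv]
  simp only [stretch, Imm.tangentialPart, innerLoop_apply, real_inner_smul_left,
    real_inner_smul_right, real_inner_comm ((γ t).tangent θ)]
  field_simp

/-- This is [∂_t, D_s] = -a D_s with a the stretch: ∂_t commutes with ∂_θ, and only the factor
|c'|⁻¹ contributes. -/
theorem velocity_Ds (hγ : IsSmoothCurve fun t => (γ t).toLoop) {f : ℝ → Loop F} (hf : IsSmoothCurve f) (t : ℝ) :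
    velocity (fun τ => (γ τ).Ds (f τ)) (isSmoothCurve_Ds hγ hf) t =
      (γ t).Ds (velocity f hf t) - smulLoop (stretch hγ t) ((γ t).Ds (f t)) := by
  refine loop_ext fun θ => velocity_eq_of_hasDerivAt _ ?_
  have hs := (γ t).speed_pos θ
  refine (((hasDerivAt_speed hγ t θ).inv hs.ne').smul
    (hasDerivAt_deriv_velocity hf t θ)).congr_deriv ?_
  rw [((γ t).hasDerivAt_loop (velocity _ hf t) θ).deriv, ((γ t).hasDerivAt_loop (f t) θ).deriv]
  simp only [Pi.inv_apply, loop_sub_apply, smulLoop_apply, smul_smul]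
  rw [inv_mul_cancel₀ hs.ne', one_smul, sub_eq_add_neg, ← neg_smul]
  congr 2
  field_simp

/-- ∂_t is moved past the k copies of D_s one at a time; passing a copy with j others outside it
leaves D_s^j (a D_s^{k-j} f). -/
theorem velocity_Ds_pow (hγ : IsSmoothCurve fun t => (γ t).toLoop) {f : ℝ → Loop F} (hf : IsSmoothCurve f) (k : ℕ) (t : ℝ) :
    velocity (fun τ => ((γ τ).Ds ^ k) (f τ)) (isSmoothCurve_Ds_pow hγ hf k) t =
      ((γ t).Ds ^ k) (velocity f hf t) - ∑ j ∈ Finset.range k,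
        ((γ t).Ds ^ j) (smulLoop (stretch hγ t) (((γ t).Ds ^ (k - j)) (f t))) := by
  induction k with
  | zero => simp
  | succ k ih =>
    have h := velocity_Ds hγ (isSmoothCurve_Ds_pow hγ hf k) t
    rw [ih, map_sub, map_sum, ← Module.End.mul_apply, ← pow_succ'] at h
    simp only [← Module.End.mul_apply, ← pow_succ'] at h
    rw [h, Finset.sum_range_succ']
    simp only [Nat.add_sub_add_right, pow_zero, Module.End.one_apply, Nat.sub_zero]
    abel

theorem isSmoothCurve_tangent (hγ : IsSmoothCurve fun t => (γ t).toLoop) : IsSmoothCurve fun t => (γ t).tangent := isSmoothCurve_Ds hγ hγ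

theorem isSmoothCurve_curvature (hγ : IsSmoothCurve fun t => (γ t).toLoop) : IsSmoothCurve fun t => (γ t).curvature :=
  ContDiff.inner ℝ (isSmoothCurve_Ds hγ (isSmoothCurve_tangent hγ))
    (contDiff_rot.comp (isSmoothCurve_tangent hγ))

theorem contDiff_speed (hγ : IsSmoothCurve fun t => (γ t).toLoop) : ContDiff ℝ ∞ fun p : ℝ × ℝ => (γ p.1).speed p.2 :=
  (contDiff_partial_right hγ).norm ℝ fun p => (γ p.1).2 p.2

theorem isSmoothCurve_logSpeed (hγ : IsSmoothCurve fun t => (γ t).toLoop) : IsSmoothCurve fun t => (γ t).logSpeed :=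
  (contDiff_speed hγ).log fun p => ((γ p.1).speed_pos p.2).ne'

theorem velocity_logSpeed (hγ : IsSmoothCurve fun t => (γ t).toLoop) (t : ℝ) : velocity _ (isSmoothCurve_logSpeed hγ) t = stretch hγ t := by
  refine loop_ext fun θ => velocity_eq_of_hasDerivAt _ ?_
  have hs := (γ t).speed_pos θ
  refine ((hasDerivAt_speed hγ t θ).log hs.ne').congr_deriv ?_
  field_simp

theorem velocity_tangent (hγ : IsSmoothCurve fun t => (γ t).toLoop) (t : ℝ) : velocity _ (isSmoothCurve_tangent hγ) t =
    (γ t).Ds (velocity _ hγ t) - smulLoop (stretch hγ t) (γ t).tangent := velocity_Ds hγ hγ t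

/-- Both sides equal ⟨D_s² h, n⟩ - 2aκ; the term ⟨D_s v, J ∂_t v⟩ drops out because ∂_t v is normal.
Writing the result with D_s b makes it parallel to ∂_t D_s log|c'| = D_s a - a D_s log|c'|. -/
theorem velocity_curvature (hγ : IsSmoothCurve fun t => (γ t).toLoop) (t : ℝ) : velocity _ (isSmoothCurve_curvature hγ) t =
    (γ t).Ds (turning hγ t) - smulLoop (stretch hγ t) (γ t).curvature := by
  refine loop_ext fun θ => velocity_eq_of_hasDerivAt _ ?_
  have ht := isSmoothCurve_tangent hγ
  refine ((hasDerivAt_velocity (isSmoothCurve_Ds hγ ht) t θ).inner ℝ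
    (rotCLM.hasFDerivAt.comp_hasDerivAt t (hasDerivAt_velocity ht t θ))).congr_deriv ?_
  rw [velocity_Ds hγ ht t, velocity_tangent hγ t, turning, Imm.Ds_normalPart, map_sub,
    Imm.Ds_smulLoop, Imm.Ds_tangent]
  simp only [Function.comp_apply, rotCLM_apply]
  set c := γ t
  set h := velocity _ hγ t
  have hvv : ⟪rot (c.tangent θ), rot (c.tangent θ)⟫ = 1 := by
    rw [inner_rot_rot, real_inner_self_eq_norm_sq, c.norm_tangent, one_pow]
  have hvn : ⟪c.tangent θ, rot (c.tangent θ)⟫ = 0 := inner_rot_self _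
  have hr : ∀ x : Plane, ⟪rot (c.tangent θ), rot x⟫ = ⟪x, c.tangent θ⟫ := fun x => by
    rw [inner_rot_rot, real_inner_comm]
  have hst : stretch hγ t θ = ⟪c.Ds h θ, c.tangent θ⟫ := rfl
  have htt : ⟪c.tangent θ, c.tangent θ⟫ = 1 := by
    rw [real_inner_self_eq_norm_sq, c.norm_tangent, one_pow]
  simp only [loop_sub_apply, loop_add_apply, smulLoop_apply,
    rotLoop_apply, inner_sub_left, inner_add_left, real_inner_smul_left, hvv, hvn, hr,
    Imm.tangentialPart, Imm.normalPart, innerLoop_apply, smul_eq_mul, hst, htt]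
  change _ + (⟪c.Ds (c.Ds h) θ, rot (c.tangent θ)⟫ - _ - _) = _
  ring

/-- The time derivative of `D_s^{k+1} log |c'|`. -/
theorem velocity_Ds_pow_logSpeed (hγ : IsSmoothCurve fun t => (γ t).toLoop) (k : ℕ) (t : ℝ) :
    velocity _ (isSmoothCurve_Ds_pow hγ (isSmoothCurve_logSpeed hγ) (k + 1)) t =
      ((γ t).Ds ^ (k + 1)) (stretch hγ t) - ∑ j ∈ Finset.range (k + 1),
        ((γ t).Ds ^ j) (smulLoop (stretch hγ t) (((γ t).Ds ^ (k - j + 1)) (γ t).logSpeed)) := by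
  rw [velocity_Ds_pow hγ (isSmoothCurve_logSpeed hγ), velocity_logSpeed hγ]
  congr 1
  refine Finset.sum_congr rfl fun j hj => ?_
  have := Finset.mem_range.1 hj
  rw [show k + 1 - j = k - j + 1 by omega]

/-- The term -aκ of ∂_t κ supplies the summand j = k, so that the sum has the same shape as the one
for log|c'|. -/
theorem velocity_Ds_pow_curvature (hγ : IsSmoothCurve fun t => (γ t).toLoop) (k : ℕ) (t : ℝ) :
    velocity _ (isSmoothCurve_Ds_pow hγ (isSmoothCurve_curvature hγ) k) t =
      ((γ t).Ds ^ (k + 1)) (turning hγ t) - ∑ j ∈ Finset.range (k + 1),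
        ((γ t).Ds ^ j) (smulLoop (stretch hγ t) (((γ t).Ds ^ (k - j)) (γ t).curvature)) := by
  rw [velocity_Ds_pow hγ (isSmoothCurve_curvature hγ), velocity_curvature hγ, map_sub,
    ← Module.End.mul_apply, ← pow_succ, Finset.sum_range_succ]
  simp only [Nat.sub_self, pow_zero, Module.End.one_apply]
  abel

end Path

/-! ### Pointwise bound for the time derivatives of the shape -/

section PointwiseEstimate

/-- The sum `|D_s h| + ... + |D_s^{k+2} h|`. -/
def derivSum (c : Imm) (h : Loop Plane) (k : ℕ) (θ : ℝ) : ℝ :=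
  ∑ i ∈ Finset.range (k + 2), ‖(c.Ds ^ (1 + i)) h θ‖

theorem derivSum_nonneg (c : Imm) (h : Loop Plane) (k : ℕ) (θ : ℝ) : 0 ≤ derivSum c h k θ :=
  Finset.sum_nonneg fun _ _ => norm_nonneg _

/-- An iterated commutator of `D_s` with the time derivative, applied to `u`, is controlled by the
derivatives of the velocity, provided that the lower derivatives of `u` are bounded. -/
theorem abs_commutator_le (c : Imm) (a : Loop ℝ) (u : ℕ → Loop ℝ)
    (hu : ∀ i j, u (i + j) = (c.Ds ^ i) (u j)) (k : ℕ) (θ B P Q : ℝ) (hB : 0 ≤ B) (hP : 0 ≤ P)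
    (hQ : 0 ≤ Q) (h0 : |a θ| ≤ P) (ha : ∀ i ≤ k, |(c.Ds ^ i) a θ| ≤ Q)
    (hb : ∀ i < k, |u i θ| ≤ B) :
    |(∑ j ∈ Finset.range (k + 1), (c.Ds ^ j) (smulLoop a (u (k - j))) : Loop ℝ) θ|
      ≤ (k + 1) * 2 ^ k * (P * |u k θ| + B * Q) := by
  rw [loop_sum_apply]
  refine (Finset.abs_sum_le_sum_abs _ _).trans ?_
  have : ∀ j ∈ Finset.range (k + 1), |(c.Ds ^ j) (smulLoop a (u (k - j))) θ|
      ≤ 2 ^ k * (P * |u k θ| + B * Q) := by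
    intro j hj
    have hj := Finset.mem_range.1 hj
    have hR : 0 ≤ P * |u k θ| + B * Q := by positivity
    have h1 : |(c.Ds ^ j) (smulLoop a (u (k - j))) θ| ≤ 2 ^ j * (P * |u k θ| + B * Q) := by
      refine c.abs_Ds_pow_smulLoop_le _ _ _ _ _ fun i l hil => ?_
      rw [← hu]
      -- If no derivative falls on a, then u has reached its top order k and is multiplied by |a| ≤
      -- P. Otherwise the order of u is below k and the bound B applies.
      rcases Nat.eq_zero_or_pos i with rfl | hi
      · rw [show l + (k - j) = k by omega, pow_zero, Module.End.one_apply]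
        have : |a θ| * |u k θ| ≤ P * |u k θ| := by gcongr
        nlinarith [mul_nonneg hB hQ]
      · have := mul_le_mul (ha i (by omega)) (hb (l + (k - j)) (by omega)) (abs_nonneg _) hQ
        nlinarith [mul_nonneg hP (abs_nonneg (u k θ))]
    refine h1.trans ?_
    gcongr
    · norm_num
    · omega
  refine (Finset.sum_le_sum this).trans (le_of_eq ?_)
  rw [Finset.sum_const, Finset.card_range, nsmul_eq_mul]
  push_cast
  ring

/-- The two quantities must be treated together: D_s^{k+1} a produces b D_s^k κ through the frame,
so the evolution of log|c'| involves the curvature of top order. Each top-order quantity is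
multiplied only by |D_s h|, so the estimate is affine in them. -/
theorem exists_abs_velocity_le (B : ℝ) (hB : 0 ≤ B) (k : ℕ) : ∃ C : ℝ, 0 ≤ C ∧
    ∀ (γ : ℝ → Imm) (hγ : IsSmoothCurve fun t => (γ t).toLoop) (t θ : ℝ),
      (∀ i < k, |((γ t).Ds ^ (i + 1)) (γ t).logSpeed θ| ≤ B) →
      (∀ i < k, |((γ t).Ds ^ i) (γ t).curvature θ| ≤ B) →
      |velocity _ (isSmoothCurve_Ds_pow hγ (isSmoothCurve_logSpeed hγ) (k + 1)) t θ|
        ≤ C * (derivSum (γ t) (velocity _ hγ t) k θ + ‖(γ t).Ds (velocity _ hγ t) θ‖ *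
          (|((γ t).Ds ^ (k + 1)) (γ t).logSpeed θ| + |((γ t).Ds ^ k) (γ t).curvature θ|)) ∧
      |velocity _ (isSmoothCurve_Ds_pow hγ (isSmoothCurve_curvature hγ) k) t θ|
        ≤ C * (derivSum (γ t) (velocity _ hγ t) k θ + ‖(γ t).Ds (velocity _ hγ t) θ‖ *
          (|((γ t).Ds ^ (k + 1)) (γ t).logSpeed θ| + |((γ t).Ds ^ k) (γ t).curvature θ|)) := by
  obtain ⟨C, hC, hparts⟩ := Imm.exists_abs_Ds_pow_parts_le B hB k
  -- The three summands account for D_s^k of a part of D_s² h, for D_s^k of κ times a part of D_s h,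
  -- and for the k + 1 commutator terms.
  refine ⟨C + 2 ^ k * (1 + B * C) + (k + 1) * 2 ^ k * (1 + B * C), by positivity,
    fun γ hγ t θ hy hκ => ?_⟩
  rw [velocity_Ds_pow_logSpeed hγ, velocity_Ds_pow_curvature hγ]
  set c := γ t
  set h := velocity _ hγ t
  set S := derivSum c h k θ with hS
  set η := ‖c.Ds h θ‖
  set Y := |(c.Ds ^ (k + 1)) c.logSpeed θ|
  set K := |(c.Ds ^ k) c.curvature θ|
  have hS0 : 0 ≤ S := derivSum_nonneg _ _ _ _
  have hη : 0 ≤ η := norm_nonneg _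
  have hY : 0 ≤ Y := abs_nonneg _
  have hK : 0 ≤ K := abs_nonneg _
  have hp := hparts c h θ hκ
  have s1 : ∑ i ∈ Finset.range (k + 1), ‖(c.Ds ^ (1 + i)) h θ‖ ≤ S := by
    rw [hS, derivSum, Finset.sum_range_succ _ (k + 1)]
    linarith [norm_nonneg ((c.Ds ^ (1 + (k + 1))) h θ)]
  have s2 : ∑ i ∈ Finset.range (k + 1), ‖(c.Ds ^ (2 + i)) h θ‖ ≤ S := by
    rw [hS, derivSum, Finset.sum_range_succ' _ (k + 1)]
    have : ∀ i, 2 + i = 1 + (i + 1) := fun i => by ring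
    simp only [this]
    linarith [norm_nonneg ((c.Ds ^ (1 + 0)) h θ)]
  have a1 : ∀ l ≤ k, |(c.Ds ^ l) (stretch hγ t) θ| ≤ C * S := fun l hl => by
    have := ((hp l hl 1).1).trans (mul_le_mul_of_nonneg_left s1 hC)
    rwa [pow_one] at this
  have b1 : ∀ l ≤ k, |(c.Ds ^ l) (turning hγ t) θ| ≤ C * S := fun l hl => by
    have := ((hp l hl 1).2).trans (mul_le_mul_of_nonneg_left s1 hC)
    rwa [pow_one] at this
  have a0 : |stretch hγ t θ| ≤ η := c.abs_tangentialPart_le _ θ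
  have b0 : |turning hγ t θ| ≤ η := c.abs_normalPart_le _ θ
  have hpow : (c.Ds ^ 2) h = c.Ds (c.Ds h) := by rw [pow_two, Module.End.mul_apply]
  have a2 : |(c.Ds ^ k) (c.tangentialPart (c.Ds (c.Ds h))) θ| ≤ C * S := by
    rw [← hpow]
    exact ((hp k le_rfl 2).1).trans (mul_le_mul_of_nonneg_left s2 hC)
  have b2 : |(c.Ds ^ k) (c.normalPart (c.Ds (c.Ds h))) θ| ≤ C * S := by
    rw [← hpow]
    exact ((hp k le_rfl 2).2).trans (mul_le_mul_of_nonneg_left s2 hC)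
  -- Only the Leibniz term in which f is not differentiated contains D_s^k κ, and there |f| ≤ |D_s
  -- h|; in every other term the lower curvature bound B is available.
  have prod : ∀ f : Loop ℝ, |f θ| ≤ η → (∀ l ≤ k, |(c.Ds ^ l) f θ| ≤ C * S) →
      |(c.Ds ^ k) (smulLoop c.curvature f) θ| ≤ 2 ^ k * (η * K + B * (C * S)) := by
    intro f hf0 hf
    refine c.abs_Ds_pow_smulLoop_le _ _ _ _ _ fun i l hil => ?_
    rcases Nat.eq_zero_or_pos l with rfl | hl
    · obtain rfl : i = k := by omega
      rw [pow_zero, Module.End.one_apply]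
      have : K * |f θ| ≤ K * η := by gcongr
      have : 0 ≤ B * (C * S) := by positivity
      linarith
    · have := mul_le_mul (hκ i (by omega)) (hf l (by omega)) (abs_nonneg _) hB
      have : 0 ≤ η * K := by positivity
      linarith
  have top1 : |(c.Ds ^ (k + 1)) (stretch hγ t) θ| ≤ C * S + 2 ^ k * (η * K + B * (C * S)) := by
    rw [pow_succ, Module.End.mul_apply, stretch, Imm.Ds_tangentialPart, map_add, loop_add_apply]
    exact (abs_add_le _ _).trans (add_le_add a2 (prod _ b0 b1))
  have top2 : |(c.Ds ^ (k + 1)) (turning hγ t) θ| ≤ C * S + 2 ^ k * (η * K + B * (C * S)) := by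
    rw [pow_succ, Module.End.mul_apply, turning, Imm.Ds_normalPart, map_sub, loop_sub_apply]
    exact (abs_sub _ _).trans (add_le_add b2 (prod _ a0 a1))
  -- The shift i + 1 is essential: log|c'| occurs only differentiated, so no bound on log|c'| itself
  -- is needed.
  have com1 := abs_commutator_le c (stretch hγ t) (fun i => (c.Ds ^ (i + 1)) c.logSpeed)
    (fun i j => by rw [add_assoc, pow_add, Module.End.mul_apply]) k θ B η (C * S) hB hη
    (by positivity) a0 a1 hy
  have com2 := abs_commutator_le c (stretch hγ t) (fun i => (c.Ds ^ i) c.curvature)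
    (fun i j => by rw [pow_add, Module.End.mul_apply]) k θ B η (C * S) hB hη
    (by positivity) a0 a1 hκ
  have hηY : 0 ≤ η * Y := by positivity
  have hηK : 0 ≤ η * K := by positivity
  have hBC : 0 ≤ B * C := by positivity
  have bound : ∀ X, 0 ≤ X → X ≤ η * (Y + K) →
      C * S + 2 ^ k * (η * K + B * (C * S)) + (k + 1) * 2 ^ k * (X + B * (C * S)) ≤
        (C + 2 ^ k * (1 + B * C) + (k + 1) * 2 ^ k * (1 + B * C)) * (S + η * (Y + K)) := by
    intro X hX hX'
    have u0 : C * S ≤ C * (S + η * (Y + K)) := by gcongr; nlinarith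
    have u1 : η * K + B * (C * S) ≤ (1 + B * C) * (S + η * (Y + K)) := by
      nlinarith [mul_nonneg hBC hηY, mul_nonneg hBC hηK]
    have u2 : X + B * (C * S) ≤ (1 + B * C) * (S + η * (Y + K)) := by
      nlinarith [mul_nonneg hBC hηY, mul_nonneg hBC hηK]
    calc _ ≤ C * (S + η * (Y + K)) + 2 ^ k * ((1 + B * C) * (S + η * (Y + K)))
          + (k + 1) * 2 ^ k * ((1 + B * C) * (S + η * (Y + K))) := by gcongr
      _ = _ := by ring
  constructor
  · refine (abs_sub _ _).trans ((add_le_add top1 com1).trans (bound (η * Y) hηY ?_))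
    nlinarith
  · refine (abs_sub _ _).trans ((add_le_add top2 com2).trans (bound (η * K) hηK ?_))
    nlinarith

end PointwiseEstimate

/-! ### Integral inequalities -/

/-- The Cauchy-Schwarz inequality for continuous functions with a continuous weight. -/
theorem sq_integral_mul_mul_le {f g w : ℝ → ℝ} (hf : Continuous f) (hg : Continuous g)
    (hw : Continuous w) (hw0 : ∀ x, 0 ≤ w x) {a b : ℝ} (hab : a ≤ b) :
    (∫ x in a..b, f x * g x * w x) ^ 2 ≤
      (∫ x in a..b, f x ^ 2 * w x) * ∫ x in a..b, g x ^ 2 * w x := by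
  have i1 : IntervalIntegrable (fun x => f x * g x * w x) volume a b :=
    ((hf.mul hg).mul hw).intervalIntegrable _ _
  have i2 : IntervalIntegrable (fun x => f x ^ 2 * w x) volume a b :=
    ((hf.pow 2).mul hw).intervalIntegrable _ _
  have i3 : IntervalIntegrable (fun x => g x ^ 2 * w x) volume a b :=
    ((hg.pow 2).mul hw).intervalIntegrable _ _
  have key : ∀ s : ℝ, 0 ≤ (∫ x in a..b, g x ^ 2 * w x) * (s * s) +
      (2 * ∫ x in a..b, f x * g x * w x) * s + ∫ x in a..b, f x ^ 2 * w x := by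
    intro s
    have h0 : 0 ≤ ∫ x in a..b, (f x + s * g x) ^ 2 * w x :=
      intervalIntegral.integral_nonneg hab fun x _ => mul_nonneg (sq_nonneg _) (hw0 x)
    have e : ∀ x, (f x + s * g x) ^ 2 * w x =
        s * s * (g x ^ 2 * w x) + 2 * s * (f x * g x * w x) + f x ^ 2 * w x := fun x => by ring
    simp only [e] at h0
    rw [intervalIntegral.integral_add ((i3.const_mul _).add (i1.const_mul _)) i2,
      intervalIntegral.integral_add (i3.const_mul _) (i1.const_mul _),
      intervalIntegral.integral_const_mul, intervalIntegral.integral_const_mul] at h0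
    linarith
  have h := discrim_le_zero key
  rw [discrim] at h
  linarith

/-- A convex sequence on `{0, ..., n}` is bounded by its values at the end points. -/
theorem le_max_of_convex_sequence {b : ℕ → ℝ} (hb : ∀ k, 2 * b (k + 1) ≤ b k + b (k + 2)) (n : ℕ) :
    ∀ k ≤ n, b k ≤ max (b 0) (b n) := by
  induction n with
  | zero => intro k hk; obtain rfl : k = 0 := by omega
            exact le_max_left _ _
  | succ n ih =>
    intro k hk
    rcases Nat.lt_or_ge n k with h | h
    · obtain rfl : k = n + 1 := by omega
      exact le_max_right _ _
    · have hn : b n ≤ max (b 0) (b (n + 1)) := by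
        rcases n with _ | m
        · exact le_max_left _ _
        · have h1 := hb m
          rcases le_max_iff.1 (ih m (by omega)) with h2 | h2
          · rcases le_total (b 0) (b (m + 1 + 1)) with h3 | h3
            · rw [max_eq_right h3]; linarith
            · rw [max_eq_left h3]; linarith
          · exact le_max_of_le_right (by linarith)
      exact (ih k h).trans (max_le (le_max_left _ _) hn)

theorem hasDerivAt_parametric_integral {g : ℝ × ℝ → ℝ} (hg : ContDiff ℝ ∞ g) (a b t : ℝ) :
    HasDerivAt (fun t => ∫ θ in a..b, g (t, θ)) (∫ θ in a..b, deriv (fun t => g (t, θ)) t) t := by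
  have hd := contDiff_partial_left hg
  obtain ⟨C, hC⟩ := ((isCompact_closedBall t 1).prod
    (isCompact_uIcc (a := a) (b := b))).exists_bound_of_continuousOn hd.continuous.continuousOn
  refine (intervalIntegral.hasDerivAt_integral_of_dominated_loc_of_deriv_le
    (F := fun t θ => g (t, θ)) (F' := fun t θ => deriv (fun t => g (t, θ)) t)
    (bound := fun _ => C) (Metric.closedBall_mem_nhds t one_pos) ?_ ?_ ?_ ?_ ?_ ?_).2
  · exact Filter.Eventually.of_forall fun x =>
      (hg.continuous.comp (Continuous.prodMk_right x)).aestronglyMeasurable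
  · exact (hg.continuous.comp (Continuous.prodMk_right t)).intervalIntegrable a b
  · exact (hd.continuous.comp (Continuous.prodMk_right t)).aestronglyMeasurable
  · exact Filter.Eventually.of_forall fun θ hθ x hx => hC (x, θ) ⟨hx, Set.uIoc_subset_uIcc hθ⟩
  · exact intervalIntegrable_const
  · exact Filter.Eventually.of_forall fun θ _ x _ =>
      ((hg.comp (contDiff_id.prodMk contDiff_const)).differentiable (by simp) x).hasDerivAt

/-- If `|u'| ≤ C g` on `[0, 1]`, then `u` varies by at most `C ∫ g`. -/
theorem abs_sub_le_of_abs_deriv_le {u u' g : ℝ → ℝ} (hu : ∀ t, HasDerivAt u (u' t) t)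
    (hu' : Continuous u') (hg : Continuous g) (hg0 : ∀ t, 0 ≤ g t) {C : ℝ} (hC : 0 ≤ C)
    (h : ∀ t ∈ Set.Icc (0 : ℝ) 1, |u' t| ≤ C * g t) {t : ℝ} (ht : t ∈ Set.Icc (0 : ℝ) 1) :
    |u t - u 0| ≤ C * ∫ s in (0 : ℝ)..1, g s := by
  rw [← intervalIntegral.integral_eq_sub_of_hasDerivAt (fun x _ => hu x)
    (hu'.intervalIntegrable _ _)]
  calc |∫ s in (0 : ℝ)..t, u' s| ≤ ∫ s in (0 : ℝ)..t, |u' s| :=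
        intervalIntegral.abs_integral_le_integral_abs ht.1
    _ ≤ ∫ s in (0 : ℝ)..t, C * g s :=
        intervalIntegral.integral_mono_on ht.1 (hu'.abs.intervalIntegrable _ _)
          ((continuous_const.mul hg).intervalIntegrable _ _)
          fun s hs => h s ⟨hs.1, hs.2.trans ht.2⟩
    _ = C * ∫ s in (0 : ℝ)..t, g s := intervalIntegral.integral_const_mul _ _
    _ ≤ C * ∫ s in (0 : ℝ)..1, g s := by
        refine mul_le_mul_of_nonneg_left ?_ hC
        exact intervalIntegral.integral_mono_interval le_rfl ht.1 ht.2
          (Filter.Eventually.of_forall hg0) (hg.intervalIntegrable _ _)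

/-! ### Sobolev inequalities with respect to arc length -/

namespace Imm

variable {F : Type*} [NormedAddCommGroup F] [NormedSpace ℝ F] (c : Imm)

theorem speed_continuous : Continuous c.speed := c.speed_contDiff.continuous

/-- The length of a curve. -/
def len : ℝ := ∫ θ in (0 : ℝ)..2 * Real.pi, c.speed θ

/-- The square of the norm in `L²(ds)`. -/
def normSq (f : Loop F) : ℝ := ∫ θ in (0 : ℝ)..2 * Real.pi, ‖f θ‖ ^ 2 * c.speed θ

theorem len_pos : 0 < c.len :=
  intervalIntegral.intervalIntegral_pos_of_pos (c.speed_continuous.intervalIntegrable _ _)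
    c.speed_pos Real.two_pi_pos

theorem normSq_nonneg (f : Loop F) : 0 ≤ c.normSq f :=
  intervalIntegral.integral_nonneg Real.two_pi_pos.le fun θ _ =>
    mul_nonneg (sq_nonneg _) (c.speed_pos θ).le

theorem intervalIntegrable_normSq (f : Loop F) (a b : ℝ) :
    IntervalIntegrable (fun θ => ‖f θ‖ ^ 2 * c.speed θ) volume a b :=
  (((loop_continuous f).norm.pow 2).mul c.speed_continuous).intervalIntegrable _ _

theorem integral_Ds (f : Loop ℝ) : ∫ θ in (0 : ℝ)..2 * Real.pi, c.speed θ * c.Ds f θ = 0 := by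
  have h : ∀ θ, HasDerivAt (f : ℝ → ℝ) (c.speed θ * c.Ds f θ) θ := fun θ => c.hasDerivAt_loop f θ
  rw [intervalIntegral.integral_eq_sub_of_hasDerivAt (fun x _ => h x)
    ((c.speed_continuous.mul (loop_continuous _)).intervalIntegrable _ _)]
  have := loop_periodic f 0
  rw [zero_add] at this
  rw [this, sub_self]

/-- Expand ‖f + D_s² f‖² ≥ 0 and integrate the cross term by parts, where D_s ⟨f, D_s f⟩ has
integral zero. Hence k ↦ ‖D_s^k f‖² is a convex sequence, so the end orders control all intermediate
ones with constant 1. -/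
theorem two_mul_normSq_Ds_le (f : Loop Plane) :
    2 * c.normSq (c.Ds f) ≤ c.normSq f + c.normSq (c.Ds (c.Ds f)) := by
  have h := c.integral_Ds (innerLoop f (c.Ds f))
  have i : ∀ g : Loop Plane, IntervalIntegrable (fun θ => ‖g θ‖ ^ 2 * c.speed θ) volume 0
    (2 * Real.pi) := fun g => c.intervalIntegrable_normSq g _ _
  have i' : IntervalIntegrable (fun θ => c.speed θ * c.Ds (innerLoop f (c.Ds f)) θ) volume 0
      (2 * Real.pi) := (c.speed_continuous.mul (loop_continuous _)).intervalIntegrable _ _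
  have e : c.normSq f + c.normSq (c.Ds (c.Ds f)) - 2 * c.normSq (c.Ds f) =
      c.normSq (f + c.Ds (c.Ds f)) -
        2 * ∫ θ in (0 : ℝ)..2 * Real.pi, c.speed θ * c.Ds (innerLoop f (c.Ds f)) θ := by
    unfold normSq
    rw [← intervalIntegral.integral_const_mul, ← intervalIntegral.integral_const_mul,
      ← intervalIntegral.integral_add (i _) (i _),
      ← intervalIntegral.integral_sub ((i _).add (i _)) ((i _).const_mul _),
      ← intervalIntegral.integral_sub (i _) (i'.const_mul _)]
    refine intervalIntegral.integral_congr fun θ _ => ?_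
    simp only [Ds_innerLoop, loop_add_apply, innerLoop_apply, norm_add_sq_real,
      real_inner_self_eq_norm_sq]
    ring
  have := c.normSq_nonneg (f + c.Ds (c.Ds f))
  rw [h] at e
  linarith

theorem normSq_Ds_pow_le (f : Loop Plane) {n k : ℕ} (hk : k ≤ n) :
    c.normSq ((c.Ds ^ k) f) ≤ c.normSq f + c.normSq ((c.Ds ^ n) f) := by
  have h := le_max_of_convex_sequence (b := fun k => c.normSq ((c.Ds ^ k) f)) (fun k => by
    simpa only [pow_succ', Module.End.mul_apply] using c.two_mul_normSq_Ds_le ((c.Ds ^ k) f)) n k hk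
  refine h.trans (max_le ?_ ?_)
  · simpa using c.normSq_nonneg _
  · simpa using c.normSq_nonneg f

/-- With u = D_s f(θ), the periodic function ⟨f, u⟩ has a critical point by Rolle, where ⟨D_s f, u⟩
= 0. Integrating from θ to that point gives |u| ≤ ∫ |D_s² f| ds, and Cauchy-Schwarz concludes. No
lower bound on the length is required. -/
theorem norm_Ds_sq_le (f : Loop Plane) (θ : ℝ) :
    ‖c.Ds f θ‖ ^ 2 ≤ c.len * c.normSq (c.Ds (c.Ds f)) := by
  set u := c.Ds f θ
  set g : Loop Plane := c.Ds (c.Ds f)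
  have hd : ∀ (f : Loop Plane) (x : ℝ),
      HasDerivAt (fun x => ⟪f x, u⟫) (c.speed x * ⟪c.Ds f x, u⟫) x := fun f x =>
    ((c.hasDerivAt_loop f x).inner ℝ (hasDerivAt_const x u)).congr_deriv (by
      rw [inner_zero_right, zero_add, real_inner_smul_left])
  have hlt : θ < θ + 2 * Real.pi := lt_add_of_pos_right _ Real.two_pi_pos
  obtain ⟨x, hx, hx0⟩ := exists_hasDerivAt_eq_zero hlt
    (fun y _ => (hd f y).continuousAt.continuousWithinAt) (by simp only [loop_periodic f θ])
    (fun y _ => hd f y)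
  replace hx0 : ⟪c.Ds f x, u⟫ = 0 := (mul_eq_zero.1 hx0).resolve_left (c.speed_pos x).ne'
  have hgc : Continuous fun y => ‖g y‖ * c.speed y :=
    (loop_continuous g).norm.mul c.speed_continuous
  have hper : ∫ y in θ..θ + 2 * Real.pi, ‖g y‖ * c.speed y =
      ∫ y in (0 : ℝ)..2 * Real.pi, ‖g y‖ * c.speed y := by
    have hp : Function.Periodic (fun y => ‖g y‖ * c.speed y) (2 * Real.pi) := fun y => by
      simp only [loop_periodic g y, c.speed_periodic y]
    simpa using hp.intervalIntegral_add_eq θ 0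
  have hint : ⟪c.Ds f x, u⟫ - ⟪u, u⟫ = ∫ y in θ..x, c.speed y * ⟪g y, u⟫ :=
    (intervalIntegral.integral_eq_sub_of_hasDerivAt (fun y _ => hd (c.Ds f) y)
      ((c.speed_continuous.mul ((loop_continuous g).inner continuous_const)).intervalIntegrable
        _ _)).symm
  have h1 : ‖u‖ ^ 2 ≤ ‖u‖ * ∫ y in (0 : ℝ)..2 * Real.pi, ‖g y‖ * c.speed y := by
    calc ‖u‖ ^ 2 = |∫ y in θ..x, c.speed y * ⟪g y, u⟫| := by
          rw [← hint, hx0, zero_sub, abs_neg, real_inner_self_eq_norm_sq, abs_of_nonneg (sq_nonneg _)]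
      _ ≤ ∫ y in θ..x, |c.speed y * ⟪g y, u⟫| :=
          intervalIntegral.abs_integral_le_integral_abs hx.1.le
      _ ≤ ∫ y in θ..x, ‖u‖ * (‖g y‖ * c.speed y) := by
          refine intervalIntegral.integral_mono_on hx.1.le
            ((c.speed_continuous.mul
              ((loop_continuous g).inner continuous_const)).abs.intervalIntegrable _ _)
            ((continuous_const.mul hgc).intervalIntegrable _ _) fun y _ => ?_
          rw [abs_mul, abs_of_pos (c.speed_pos y)]
          have := mul_le_mul_of_nonneg_left (abs_real_inner_le_norm (g y) u) (c.speed_pos y).le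
          linarith
      _ = ‖u‖ * ∫ y in θ..x, ‖g y‖ * c.speed y := intervalIntegral.integral_const_mul _ _
      _ ≤ ‖u‖ * ∫ y in θ..θ + 2 * Real.pi, ‖g y‖ * c.speed y := by
          refine mul_le_mul_of_nonneg_left ?_ (norm_nonneg u)
          exact intervalIntegral.integral_mono_interval le_rfl hx.1.le hx.2.le
            (Filter.Eventually.of_forall fun y => mul_nonneg (norm_nonneg _) (c.speed_pos y).le)
            (hgc.intervalIntegrable _ _)
      _ = _ := by rw [hper]
  have h2 := sq_integral_mul_mul_le (continuous_const (y := (1 : ℝ))) (loop_continuous g).norm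
    c.speed_continuous (fun y => (c.speed_pos y).le) Real.two_pi_pos.le
  simp only [one_mul, one_pow] at h2
  refine le_trans ?_ h2
  set I := ∫ y in (0 : ℝ)..2 * Real.pi, ‖g y‖ * c.speed y
  rcases (norm_nonneg u).eq_or_lt with h0 | h0
  · rw [← h0, zero_pow two_ne_zero]; positivity
  · have : ‖u‖ ≤ I := by
      rw [pow_two] at h1
      exact le_of_mul_le_mul_left h1 h0
    gcongr

/-- Below the top order, the derivatives of a vector field are uniformly bounded by the `Hⁿ(ds)`
norm. -/
theorem norm_Ds_pow_sq_le (f : Loop Plane) {n j : ℕ} (hj : 1 ≤ j) (hjn : j + 1 ≤ n) (θ : ℝ) :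
    ‖(c.Ds ^ j) f θ‖ ^ 2 ≤ c.len * (c.normSq f + c.normSq ((c.Ds ^ n) f)) := by
  obtain ⟨i, rfl⟩ : ∃ i, j = i + 1 := ⟨j - 1, by omega⟩
  have h := c.norm_Ds_sq_le ((c.Ds ^ i) f) θ
  simp only [← Module.End.mul_apply, ← pow_succ'] at h
  exact h.trans (mul_le_mul_of_nonneg_left (c.normSq_Ds_pow_le f hjn) c.len_pos.le)

end Imm

/-! ### Growth estimates along paths -/

theorem hasDerivAt_integral_of_contDiff {g : ℝ × ℝ → ℝ} (hg : ContDiff ℝ ∞ g) {a b t : ℝ}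
    {g' : ℝ → ℝ} (hd : ∀ θ, HasDerivAt (fun τ => g (τ, θ)) (g' θ) t) :
    HasDerivAt (fun τ => ∫ θ in a..b, g (τ, θ)) (∫ θ in a..b, g' θ) t := by
  have h := hasDerivAt_parametric_integral hg a b t
  simpa only [fun θ => (hd θ).deriv] using h

theorem abs_sub_le_of_contDiff {u g : ℝ → ℝ} (hu : ContDiff ℝ ∞ u) (hg : Continuous g)
    (hg0 : ∀ t, 0 ≤ g t) {C : ℝ} (hC : 0 ≤ C)
    (h : ∀ t ∈ Set.Icc (0 : ℝ) 1, ∃ d, HasDerivAt u d t ∧ |d| ≤ C * g t) {t : ℝ}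
    (ht : t ∈ Set.Icc (0 : ℝ) 1) : |u t - u 0| ≤ C * ∫ s in (0 : ℝ)..1, g s :=
  abs_sub_le_of_abs_deriv_le (fun t => (hu.differentiable (by simp) t).hasDerivAt)
    (contDiff_deriv hu).continuous hg hg0 hC (fun s hs => by
      obtain ⟨d, hd, hd'⟩ := h s hs
      rwa [hd.deriv]) ht

/-- A Gronwall estimate. -/
theorem one_add_le_mul_exp {u g : ℝ → ℝ} (hu : ContDiff ℝ ∞ u) (hu0 : ∀ t, 0 ≤ u t)
    (hg : Continuous g) (hg0 : ∀ t, 0 ≤ g t) {C : ℝ} (hC : 0 ≤ C)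
    (h : ∀ t ∈ Set.Icc (0 : ℝ) 1, ∃ d, HasDerivAt u d t ∧ |d| ≤ C * g t * (1 + u t)) {t : ℝ}
    (ht : t ∈ Set.Icc (0 : ℝ) 1) :
    1 + u t ≤ (1 + u 0) * Real.exp (C * ∫ s in (0 : ℝ)..1, g s) := by
  have pos : ∀ t, 0 < 1 + u t := fun t => by linarith [hu0 t]
  -- The added 1 keeps the logarithm smooth where u vanishes.
  have key := abs_sub_le_of_contDiff (u := fun t => Real.log (1 + u t))
    ((contDiff_const.add hu).log fun t => (pos t).ne') hg hg0 hC (fun s hs => by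
      obtain ⟨d, hd, hd'⟩ := h s hs
      refine ⟨_, (hd.const_add 1).log (pos s).ne', ?_⟩
      rw [abs_div, abs_of_pos (pos s), div_le_iff₀ (pos s)]
      exact hd') ht
  have h1 : Real.log (1 + u t) ≤ Real.log (1 + u 0) + C * ∫ s in (0 : ℝ)..1, g s := by
    linarith [(abs_le.1 key).2]
  have h2 := Real.exp_le_exp.2 h1
  rwa [Real.exp_add, Real.exp_log (pos t), Real.exp_log (pos 0)] at h2

/-- The metric is stronger than the `Hⁿ(ds)` metric. -/
def Coercive (G : RiemannianMetric) (n : ℕ) (A : ℝ) : Prop :=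
  ∀ (c : Imm) (h : Loop Plane), c.normSq h + c.normSq ((c.Ds ^ n) h) ≤ A * G.form c h h

/-! ### Control of the velocity by the metric speed -/

section MetricSpeed

variable (G : RiemannianMetric) {γ : ℝ → Imm}

/-- The speed of a path with respect to `G`. -/
def metricSpeed (hγ : IsSmoothCurve fun t => (γ t).toLoop) (t : ℝ) : ℝ :=
  √(G.form (γ t) (velocity _ hγ t) (velocity _ hγ t))

theorem form_self_nonneg (c : Imm) (h : Loop Plane) : 0 ≤ G.form c h h := by
  by_cases h0 : h = 0
  · simp [h0]
  · exact (G.pos c h h0).le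

variable (hγ : IsSmoothCurve fun t => (γ t).toLoop)

theorem metricSpeed_nonneg (t : ℝ) : 0 ≤ metricSpeed G hγ t := Real.sqrt_nonneg _

theorem metricSpeed_sq (t : ℝ) :
    metricSpeed G hγ t ^ 2 = G.form (γ t) (velocity _ hγ t) (velocity _ hγ t) :=
  Real.sq_sqrt (form_self_nonneg G _ _)

theorem metricSpeed_continuous : Continuous (metricSpeed G hγ) :=
  (G.smooth γ _ _ hγ (isSmoothCurve_velocity hγ) (isSmoothCurve_velocity hγ)).continuous.sqrt

theorem integral_metricSpeed_nonneg : 0 ≤ ∫ t in (0 : ℝ)..1, metricSpeed G hγ t :=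
  intervalIntegral.integral_nonneg zero_le_one fun t _ => metricSpeed_nonneg G hγ t

theorem pathLength_eq :
    pathLength G γ hγ = ENNReal.ofReal (∫ t in (0 : ℝ)..1, metricSpeed G hγ t) := by
  rw [intervalIntegral.integral_of_le zero_le_one, ← integral_Icc_eq_integral_Ioc,
    ofReal_integral_eq_lintegral_ofReal]
  · rfl
  · exact (metricSpeed_continuous G hγ).continuousOn.integrableOn_Icc
  · exact Filter.Eventually.of_forall (metricSpeed_nonneg G hγ)

variable {G} {n : ℕ} {A : ℝ}

theorem Coercive.energy_le (hG : Coercive G n A) (t : ℝ) :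
    (γ t).normSq (velocity _ hγ t) + (γ t).normSq (((γ t).Ds ^ n) (velocity _ hγ t))
      ≤ A * metricSpeed G hγ t ^ 2 := by
  rw [metricSpeed_sq]
  exact hG _ _

theorem Coercive.normSq_le (hG : Coercive G n A) {j : ℕ} (hj : j ≤ n) (t : ℝ) :
    (γ t).normSq (((γ t).Ds ^ j) (velocity _ hγ t)) ≤ A * metricSpeed G hγ t ^ 2 :=
  ((γ t).normSq_Ds_pow_le _ hj).trans (hG.energy_le hγ t)

theorem Coercive.norm_le (hG : Coercive G n A) (hA : 0 < A) {Λ : ℝ} {t : ℝ}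
    (hΛ : (γ t).len ≤ Λ) {j : ℕ} (hj : 1 ≤ j) (hjn : j + 1 ≤ n) (θ : ℝ) :
    ‖((γ t).Ds ^ j) (velocity _ hγ t) θ‖ ≤ √(Λ * A) * metricSpeed G hγ t := by
  have h0 : 0 ≤ Λ := (γ t).len_pos.le.trans hΛ
  refine abs_le_of_sq_le_sq' ?_ (mul_nonneg (Real.sqrt_nonneg _) (metricSpeed_nonneg G hγ t)) |>.2
  rw [mul_pow, Real.sq_sqrt (by positivity), mul_assoc]
  refine ((γ t).norm_Ds_pow_sq_le _ hj hjn θ).trans ?_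
  exact mul_le_mul hΛ (hG.energy_le hγ t) (add_nonneg (Imm.normSq_nonneg _ _)
    (Imm.normSq_nonneg _ _)) h0

theorem Coercive.norm_Ds_le (hG : Coercive G n A) (hn : 2 ≤ n) (hA : 0 < A) {Λ : ℝ} {t : ℝ}
    (hΛ : (γ t).len ≤ Λ) (θ : ℝ) :
    ‖(γ t).Ds (velocity _ hγ t) θ‖ ≤ √(Λ * A) * metricSpeed G hγ t := by
  simpa using hG.norm_le hγ hA hΛ le_rfl hn θ

theorem derivSum_continuous (c : Imm) (h : Loop Plane) (k : ℕ) : Continuous (derivSum c h k) :=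
  continuous_finsetSum _ fun _ _ => (loop_continuous _).norm

theorem Coercive.derivSum_le (hG : Coercive G n A) (hA : 0 < A) {Λ : ℝ} {t : ℝ}
    (hΛ : (γ t).len ≤ Λ) {k : ℕ} (hk : k + 3 ≤ n) (θ : ℝ) :
    derivSum (γ t) (velocity _ hγ t) k θ ≤ (k + 2) * (√(Λ * A) * metricSpeed G hγ t) := by
  refine (Finset.sum_le_card_nsmul _ _ (√(Λ * A) * metricSpeed G hγ t) fun i hi => ?_).trans ?_
  · have := Finset.mem_range.1 hi
    exact hG.norm_le hγ hA hΛ (by omega) (by omega) θ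
  · simp

/-- In L²(ds) the top order k + 2 = n is allowed, whereas the sup bound `Coercive.derivSum_le` stops
one order earlier. This loss is why the last order needs an integrated Gronwall argument. -/
theorem Coercive.integral_derivSum_sq_le (hG : Coercive G n A) {k : ℕ} (hk : k + 2 ≤ n) (t : ℝ) :
    ∫ θ in (0 : ℝ)..2 * Real.pi, derivSum (γ t) (velocity _ hγ t) k θ ^ 2 * (γ t).speed θ
      ≤ (k + 2) ^ 2 * (A * metricSpeed G hγ t ^ 2) := by
  set c := γ t
  set h := velocity _ hγ t
  have hc : ∀ i, Continuous fun θ => ‖(c.Ds ^ (1 + i)) h θ‖ ^ 2 * c.speed θ := fun i =>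
    ((loop_continuous _).norm.pow 2).mul c.speed_continuous
  calc _ ≤ ∫ θ in (0 : ℝ)..2 * Real.pi, (k + 2) *
        ∑ i ∈ Finset.range (k + 2), ‖(c.Ds ^ (1 + i)) h θ‖ ^ 2 * c.speed θ := by
        refine intervalIntegral.integral_mono_on Real.two_pi_pos.le
          ((((derivSum_continuous c h k).pow 2).mul c.speed_continuous).intervalIntegrable _ _)
          ((continuous_const.mul (continuous_finsetSum _ fun i _ => hc i)).intervalIntegrable _ _)
          fun θ _ => ?_
        have := sq_sum_le_card_mul_sum_sq (s := Finset.range (k + 2))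
          (f := fun i => ‖(c.Ds ^ (1 + i)) h θ‖)
        rw [Finset.card_range] at this
        push_cast at this
        rw [← Finset.sum_mul, ← mul_assoc]
        exact mul_le_mul_of_nonneg_right this (c.speed_pos θ).le
    _ = (k + 2) * ∑ i ∈ Finset.range (k + 2), c.normSq ((c.Ds ^ (1 + i)) h) := by
        rw [intervalIntegral.integral_const_mul, intervalIntegral.integral_finsetSum fun i _ =>
          (hc i).intervalIntegrable _ _]
        rfl
    _ ≤ (k + 2) * ((k + 2) * (A * metricSpeed G hγ t ^ 2)) := by
        refine mul_le_mul_of_nonneg_left ?_ (by positivity)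
        refine (Finset.sum_le_card_nsmul _ _ (A * metricSpeed G hγ t ^ 2) fun i hi => ?_).trans ?_
        · have := Finset.mem_range.1 hi
          exact hG.normSq_le hγ (by omega) t
        · simp
    _ = _ := by ring

end MetricSpeed

/-! ### Propagation of length and pointwise bounds -/

section Propagation

variable {G : RiemannianMetric} {n : ℕ} {A : ℝ}

/-- The derivative of the length is ∫ a ds. By Cauchy-Schwarz its modulus is at most √len times the
L²(ds) norm of D_s h, and √len ≤ 1 + len. -/
theorem Coercive.len_le (hG : Coercive G n A) (hn : 2 ≤ n) (hA : 0 < A) {γ : ℝ → Imm}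
    (hγ : IsSmoothCurve fun t => (γ t).toLoop) {t : ℝ} (ht : t ∈ Set.Icc (0 : ℝ) 1) :
    1 + (γ t).len ≤
      (1 + (γ 0).len) * Real.exp (√A * ∫ s in (0 : ℝ)..1, metricSpeed G hγ s) := by
  refine one_add_le_mul_exp (u := fun t => (γ t).len)
    (contDiff_parametric_integral (contDiff_speed hγ) _ _) (fun t => (γ t).len_pos.le)
    (metricSpeed_continuous G hγ) (metricSpeed_nonneg G hγ) (Real.sqrt_nonneg A)
    (fun s _ => ⟨_, hasDerivAt_integral_of_contDiff (contDiff_speed hγ)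
      (hasDerivAt_speed hγ s), ?_⟩) ht
  set c := γ s
  set h := velocity _ hγ s
  set g := metricSpeed G hγ s
  have hg : 0 ≤ g := metricSpeed_nonneg G hγ s
  have hlen := c.len_pos
  have cs := sq_integral_mul_mul_le (continuous_const (y := (1 : ℝ)))
    (loop_continuous (stretch hγ s)) c.speed_continuous (fun y => (c.speed_pos y).le)
    Real.two_pi_pos.le
  simp only [one_mul, one_pow] at cs
  have h1 : ∫ θ in (0 : ℝ)..2 * Real.pi, stretch hγ s θ ^ 2 * c.speed θ ≤ A * g ^ 2 := by
    refine le_trans ?_ (hG.normSq_le hγ (j := 1) (by omega) s)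
    refine intervalIntegral.integral_mono_on Real.two_pi_pos.le
      ((((loop_continuous _).pow 2).mul c.speed_continuous).intervalIntegrable _ _)
      (c.intervalIntegrable_normSq _ _ _) fun θ _ => ?_
    refine mul_le_mul_of_nonneg_right (sq_le_sq' ?_ ?_) (c.speed_pos θ).le
    · rw [pow_one]; exact (abs_le.1 (c.abs_tangentialPart_le _ θ)).1
    · rw [pow_one]; exact (abs_le.1 (c.abs_tangentialPart_le _ θ)).2
  simp only [mul_comm (c.speed _)]
  refine abs_le_of_sq_le_sq (cs.trans ?_) (by positivity)
  calc c.len * _ ≤ c.len * (A * g ^ 2) := by gcongr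
    _ ≤ (1 + c.len) ^ 2 * (A * g ^ 2) := by gcongr; nlinarith
    _ = (√A * g * (1 + c.len)) ^ 2 := by
        rw [mul_pow, mul_pow, Real.sq_sqrt hA.le]; ring

/-- The functions `D_s^{k+1} log |c'|` and `D_s^k κ` are bounded by `B` at `θ`. -/
def PointwiseBound (k : ℕ) (B : ℝ) (c : Imm) (θ : ℝ) : Prop :=
  |(c.Ds ^ (k + 1)) c.logSpeed θ| ≤ B ∧ |(c.Ds ^ k) c.curvature θ| ≤ B

/-- The sum of the squares of the `L²(ds)` norms of `D_s^{k+1} log |c'|` and `D_s^k κ`. -/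
def shapeEnergy (k : ℕ) (c : Imm) : ℝ :=
  c.normSq ((c.Ds ^ (k + 1)) c.logSpeed) + c.normSq ((c.Ds ^ k) c.curvature)

theorem shapeEnergy_nonneg (k : ℕ) (c : Imm) : 0 ≤ shapeEnergy k c :=
  add_nonneg (c.normSq_nonneg _) (c.normSq_nonneg _)

/-- For fixed θ, y_k² + κ_k² satisfies a linear differential inequality in t, since for k + 3 ≤ n
all derivatives of h involved are bounded by the metric speed. -/
theorem Coercive.exists_pointwiseBound_step (hG : Coercive G n A) (hA : 0 < A) {k : ℕ}
    (hk : k + 3 ≤ n) {Λ B : ℝ} (N : ℝ) (hB : 0 ≤ B) : ∃ B' : ℝ, ∀ (γ : ℝ → Imm)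
      (hγ : IsSmoothCurve fun t => (γ t).toLoop),
      (∀ t ∈ Set.Icc (0 : ℝ) 1, (γ t).len ≤ Λ) →
      (∀ t ∈ Set.Icc (0 : ℝ) 1, ∀ θ, ∀ i < k, PointwiseBound i B (γ t) θ) →
      (∀ θ, PointwiseBound k B (γ 0) θ) → ∫ s in (0 : ℝ)..1, metricSpeed G hγ s ≤ N →
      ∀ t ∈ Set.Icc (0 : ℝ) 1, ∀ θ, PointwiseBound k B' (γ t) θ := by
  obtain ⟨C, hC, hvel⟩ := exists_abs_velocity_le B hB k
  -- The factor 6 is 2 from differentiating squares times 3 from (p + q)(1 + p + q) ≤ 3(1 + p² +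
  -- q²).
  set D : ℝ := 6 * C * (k + 2) * √(Λ * A) with hD
  have hD0 : 0 ≤ D := by positivity
  refine ⟨(1 + (B ^ 2 + B ^ 2)) * Real.exp (D * N), fun γ hγ hΛ hlow h0 hN t ht θ => ?_⟩
  have sy := isSmoothCurve_Ds_pow hγ (isSmoothCurve_logSpeed hγ) (k + 1)
  have sκ := isSmoothCurve_Ds_pow hγ (isSmoothCurve_curvature hγ) k
  have restrict : ∀ {f : ℝ → Loop ℝ}, IsSmoothCurve f → ContDiff ℝ ∞ fun t => f t θ :=
    fun hf => ContDiff.comp (g := fun p : ℝ × ℝ => _) hf (contDiff_id.prodMk contDiff_const)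
  set y : ℝ → ℝ := fun t => ((γ t).Ds ^ (k + 1)) (γ t).logSpeed θ with hy
  set κ : ℝ → ℝ := fun t => ((γ t).Ds ^ k) (γ t).curvature θ with hκ
  have growth := one_add_le_mul_exp (u := fun t => y t ^ 2 + κ t ^ 2)
    (((restrict sy).pow 2).add ((restrict sκ).pow 2)) (fun t => by positivity)
    (metricSpeed_continuous G hγ) (metricSpeed_nonneg G hγ) hD0 (fun s hs => ⟨_,
      ((hasDerivAt_velocity sy s θ).pow 2).add ((hasDerivAt_velocity sκ s θ).pow 2), ?_⟩) ht
  · have hy0 : y 0 ^ 2 ≤ B ^ 2 := sq_le_sq' (abs_le.1 (h0 θ).1).1 (abs_le.1 (h0 θ).1).2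
    have hκ0 : κ 0 ^ 2 ≤ B ^ 2 := sq_le_sq' (abs_le.1 (h0 θ).2).1 (abs_le.1 (h0 θ).2).2
    have h1 : 1 + (y t ^ 2 + κ t ^ 2) ≤ (1 + (B ^ 2 + B ^ 2)) * Real.exp (D * N) :=
      growth.trans (by gcongr)
    constructor
    · refine le_trans ?_ h1
      change |y t| ≤ _
      nlinarith [sq_abs (y t), sq_nonneg (|y t| - 1), sq_nonneg (κ t)]
    · refine le_trans ?_ h1
      change |κ t| ≤ _
      nlinarith [sq_abs (κ t), sq_nonneg (|κ t| - 1), sq_nonneg (y t)]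
  · obtain ⟨v1, v2⟩ := hvel γ hγ s θ (fun i hi => (hlow s hs θ i hi).1)
      (fun i hi => (hlow s hs θ i hi).2)
    have hS := hG.derivSum_le hγ hA (hΛ s hs) hk θ
    have hη := hG.norm_Ds_le hγ (by omega) hA (hΛ s hs) θ
    set r := √(Λ * A) * metricSpeed G hγ s with hr
    have hr0 : 0 ≤ r := mul_nonneg (Real.sqrt_nonneg _) (metricSpeed_nonneg G hγ s)
    change |velocity _ sy s θ| ≤ C * (_ + _ * (|y s| + |κ s|)) at v1
    change |velocity _ sκ s θ| ≤ C * (_ + _ * (|y s| + |κ s|)) at v2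
    have hw : C * (derivSum (γ s) (velocity _ hγ s) k θ +
        ‖(γ s).Ds (velocity _ hγ s) θ‖ * (|y s| + |κ s|)) ≤
          C * ((k + 2) * r) * (1 + (|y s| + |κ s|)) := by
      have : derivSum (γ s) (velocity _ hγ s) k θ +
        ‖(γ s).Ds (velocity _ hγ s) θ‖ * (|y s| + |κ s|) ≤
          (k + 2) * r + (k + 2) * r * (|y s| + |κ s|) := by
        gcongr
        have : (0 : ℝ) ≤ k := Nat.cast_nonneg k
        nlinarith
      calc _ ≤ C * ((k + 2) * r + (k + 2) * r * (|y s| + |κ s|)) := by gcongr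
        _ = _ := by ring
    have w1 := v1.trans hw
    have w2 := v2.trans hw
    set E := C * ((k + 2) * r)
    have hE : 0 ≤ E := by positivity
    have hDE : D * metricSpeed G hγ s = 6 * E := by simp only [hD, E, hr]; ring
    rw [hDE]
    have q1 := mul_le_mul_of_nonneg_left w1 (abs_nonneg (y s))
    have q2 := mul_le_mul_of_nonneg_left w2 (abs_nonneg (κ s))
    have hfin : (|y s| + |κ s|) * (1 + (|y s| + |κ s|)) ≤ 3 * (1 + (y s ^ 2 + κ s ^ 2)) := by
      nlinarith [sq_abs (y s), sq_abs (κ s), sq_nonneg (|y s| - 1), sq_nonneg (|κ s| - 1),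
        sq_nonneg (|y s| - |κ s|)]
    have q3 := mul_le_mul_of_nonneg_left hfin hE
    refine (abs_add_le _ _).trans ?_
    simp only [abs_mul, Nat.cast_ofNat, Nat.abs_ofNat, Nat.add_one_sub_one, pow_one]
    change 2 * |y s| * _ + 2 * |κ s| * _ ≤ _
    nlinarith

end Propagation

/-! ### Propagation of the top-order energy -/

section Shape

variable {G : RiemannianMetric} {n : ℕ} {A : ℝ}

theorem PointwiseBound.mono {k : ℕ} {B B' : ℝ} {c : Imm} {θ : ℝ} (h : PointwiseBound k B c θ)
    (hB : B ≤ B') : PointwiseBound k B' c θ := ⟨h.1.trans hB, h.2.trans hB⟩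

/-- Induction on the order: the Gronwall constant at order m depends on the bounds already obtained,
along the whole path, at orders below m. -/
theorem Coercive.exists_pointwiseBound (hG : Coercive G n A) (hA : 0 < A) (Λ : ℝ) {B : ℝ} (N : ℝ)
    (hB : 0 ≤ B) (m : ℕ) (hm : m + 2 ≤ n) : ∃ B' : ℝ, 0 ≤ B' ∧ ∀ (γ : ℝ → Imm)
      (hγ : IsSmoothCurve fun t => (γ t).toLoop),
      (∀ t ∈ Set.Icc (0 : ℝ) 1, (γ t).len ≤ Λ) →
      (∀ θ, ∀ i < m, PointwiseBound i B (γ 0) θ) → ∫ s in (0 : ℝ)..1, metricSpeed G hγ s ≤ N →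
      ∀ t ∈ Set.Icc (0 : ℝ) 1, ∀ θ, ∀ i < m, PointwiseBound i B' (γ t) θ := by
  induction m with
  | zero => exact ⟨0, le_rfl, fun γ hγ _ _ _ t _ θ i hi => absurd hi (Nat.not_lt_zero i)⟩
  | succ m ih =>
    obtain ⟨B₁, hB₁, h₁⟩ := ih (by omega)
    obtain ⟨B₂, h₂⟩ := hG.exists_pointwiseBound_step (Λ := Λ) hA (k := m) (by omega) N
      (le_max_of_le_left hB : 0 ≤ max B B₁)
    refine ⟨max B₁ B₂, le_max_of_le_left hB₁, fun γ hγ hΛ h0 hN t ht θ i hi => ?_⟩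
    have low := h₁ γ hγ hΛ (fun θ i hi => h0 θ i (by omega)) hN
    rcases Nat.lt_or_ge i m with him | him
    · exact (low t ht θ i him).mono (le_max_left _ _)
    · obtain rfl : i = m := by omega
      exact (h₂ γ hγ hΛ (fun s hs θ j hj => (low s hs θ j hj).mono (le_max_right _ _))
        (fun θ => (h0 θ i hi).mono (le_max_left _ _)) hN t ht θ).mono (le_max_right _ _)

/-- The function of `θ` which controls the time derivatives of `D_s^{k+1} log |c'|` and
`D_s^k κ`. -/
def shapeVelocityBound (k : ℕ) (c : Imm) (h : Loop Plane) (θ : ℝ) : ℝ :=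
  derivSum c h k θ +
    ‖c.Ds h θ‖ * (|(c.Ds ^ (k + 1)) c.logSpeed θ| + |(c.Ds ^ k) c.curvature θ|)

theorem shapeVelocityBound_nonneg (k : ℕ) (c : Imm) (h : Loop Plane) (θ : ℝ) :
    0 ≤ shapeVelocityBound k c h θ :=
  add_nonneg (derivSum_nonneg _ _ _ _) (by positivity)

theorem shapeVelocityBound_continuous (k : ℕ) (c : Imm) (h : Loop Plane) :
    Continuous (shapeVelocityBound k c h) :=
  (derivSum_continuous c h k).add ((loop_continuous _).norm.mul
    ((loop_continuous _).abs.add (loop_continuous _).abs))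

/-- The derivative sum is estimated in L², while |D_s h| is estimated uniformly and pulled out of
the integral, leaving the energy. -/
theorem Coercive.integral_shapeVelocityBound_sq_le (hG : Coercive G n A) (hA : 0 < A) {k : ℕ}
    (hk : k + 2 ≤ n) {γ : ℝ → Imm} (hγ : IsSmoothCurve fun t => (γ t).toLoop) {Λ t : ℝ}
    (hΛ : (γ t).len ≤ Λ) :
    ∫ θ in (0 : ℝ)..2 * Real.pi,
        shapeVelocityBound k (γ t) (velocity _ hγ t) θ ^ 2 * (γ t).speed θ ≤
      (2 * (k + 2) ^ 2 * A + 4 * (Λ * A)) * metricSpeed G hγ t ^ 2 *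
        (1 + shapeEnergy k (γ t)) := by
  have hS := hG.integral_derivSum_sq_le hγ hk t
  have hη := hG.norm_Ds_le hγ (by omega) hA hΛ
  have hΛ0 : 0 ≤ Λ := (γ t).len_pos.le.trans hΛ
  set c := γ t
  set h := velocity _ hγ t
  set g := metricSpeed G hγ t
  have i1 : IntervalIntegrable (fun θ => derivSum c h k θ ^ 2 * c.speed θ) volume 0
      (2 * Real.pi) :=
    (((derivSum_continuous c h k).pow 2).mul c.speed_continuous).intervalIntegrable _ _
  have i2 := c.intervalIntegrable_normSq ((c.Ds ^ (k + 1)) c.logSpeed) 0 (2 * Real.pi)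
  have i3 := c.intervalIntegrable_normSq ((c.Ds ^ k) c.curvature) 0 (2 * Real.pi)
  have hφ := shapeEnergy_nonneg k c
  calc _ ≤ ∫ θ in (0 : ℝ)..2 * Real.pi, (2 * (derivSum c h k θ ^ 2 * c.speed θ) +
        4 * (√(Λ * A) * g) ^ 2 * (‖(c.Ds ^ (k + 1)) c.logSpeed θ‖ ^ 2 * c.speed θ +
          ‖(c.Ds ^ k) c.curvature θ‖ ^ 2 * c.speed θ)) := by
        refine intervalIntegral.integral_mono_on Real.two_pi_pos.le
          ((((shapeVelocityBound_continuous k c h).pow 2).mul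
            c.speed_continuous).intervalIntegrable _ _)
          ((i1.const_mul _).add ((i2.add i3).const_mul _)) fun θ _ => ?_
        have hs := (c.speed_pos θ).le
        have h1 : ‖c.Ds h θ‖ ^ 2 ≤ (√(Λ * A) * g) ^ 2 :=
          pow_le_pow_left₀ (norm_nonneg _) (hη θ) 2
        have h2 : shapeVelocityBound k c h θ ^ 2 ≤ 2 * derivSum c h k θ ^ 2 +
            4 * (√(Λ * A) * g) ^ 2 * (‖(c.Ds ^ (k + 1)) c.logSpeed θ‖ ^ 2 +
              ‖(c.Ds ^ k) c.curvature θ‖ ^ 2) := by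
          rw [shapeVelocityBound]
          simp only [Real.norm_eq_abs (((c.Ds ^ (k + 1)) c.logSpeed : Loop ℝ) θ),
            Real.norm_eq_abs (((c.Ds ^ k) c.curvature : Loop ℝ) θ)]
          set p := |(c.Ds ^ (k + 1)) c.logSpeed θ|
          set q := |(c.Ds ^ k) c.curvature θ|
          have h3 : (‖c.Ds h θ‖ * (p + q)) ^ 2 ≤ (√(Λ * A) * g) ^ 2 * (2 * (p ^ 2 + q ^ 2)) := by
            rw [mul_pow]
            refine mul_le_mul h1 ?_ (sq_nonneg _) (sq_nonneg _)
            nlinarith [sq_nonneg (p - q)]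
          nlinarith [sq_nonneg (derivSum c h k θ - ‖c.Ds h θ‖ * (p + q))]
        refine (mul_le_mul_of_nonneg_right h2 hs).trans (le_of_eq ?_)
        ring
    _ = 2 * (∫ θ in (0 : ℝ)..2 * Real.pi, derivSum c h k θ ^ 2 * c.speed θ) +
        4 * (√(Λ * A) * g) ^ 2 * shapeEnergy k c := by
        rw [intervalIntegral.integral_add (i1.const_mul _) ((i2.add i3).const_mul _),
          intervalIntegral.integral_const_mul, intervalIntegral.integral_const_mul,
          intervalIntegral.integral_add i2 i3]
        rfl
    _ ≤ 2 * ((k + 2) ^ 2 * (A * g ^ 2)) + 4 * (√(Λ * A) * g) ^ 2 * shapeEnergy k c := by gcongr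
    _ = 2 * (k + 2) ^ 2 * A * g ^ 2 + 4 * (Λ * A) * g ^ 2 * shapeEnergy k c := by
        rw [mul_pow, Real.sq_sqrt (by positivity)]; ring
    _ ≤ _ := by
        have u1 : 0 ≤ 2 * (k + 2) ^ 2 * A * g ^ 2 * shapeEnergy k c := by positivity
        have u2 : 0 ≤ 4 * (Λ * A) * g ^ 2 := by positivity
        nlinarith

/-- Gronwall for the L²(ds) energy. Besides y_k and κ_k, the arc length element is differentiated in
time, which adds the factor a; it is absorbed in the same bound since |a| ≤ |D_s h|. -/
theorem Coercive.exists_shapeEnergy_le (hG : Coercive G n A) (hA : 0 < A) {k : ℕ}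
    (hk : k + 2 ≤ n) (Λ : ℝ) {B : ℝ} (N : ℝ) (hB : 0 ≤ B) : ∃ B' : ℝ, ∀ (γ : ℝ → Imm)
      (hγ : IsSmoothCurve fun t => (γ t).toLoop),
      (∀ t ∈ Set.Icc (0 : ℝ) 1, (γ t).len ≤ Λ) →
      (∀ t ∈ Set.Icc (0 : ℝ) 1, ∀ θ, ∀ i < k, PointwiseBound i B (γ t) θ) →
      shapeEnergy k (γ 0) ≤ B → ∫ s in (0 : ℝ)..1, metricSpeed G hγ s ≤ N →
      ∀ t ∈ Set.Icc (0 : ℝ) 1, shapeEnergy k (γ t) ≤ B' := by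
  obtain ⟨C, hC, hvel⟩ := exists_abs_velocity_le B hB k
  set Q : ℝ := 2 * (k + 2) ^ 2 * A + 4 * (Λ * A) with hQ
  -- Pointwise, the derivative of the integrand is at most (2C + 1)(|y| + |κ|)V|c'|, where 2C comes
  -- from the squares and 1 from the arc length element. Cauchy-Schwarz then gives the factor 2√Q.
  set D : ℝ := 2 * (2 * C + 1) * √Q with hD
  have hD0 : 0 ≤ D := by positivity
  refine ⟨(1 + B) * Real.exp (D * N), fun γ hγ hΛ hlow h0 hN t ht => ?_⟩
  have sy := isSmoothCurve_Ds_pow hγ (isSmoothCurve_logSpeed hγ) (k + 1)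
  have sκ := isSmoothCurve_Ds_pow hγ (isSmoothCurve_curvature hγ) k
  have hΛ0 : 0 ≤ Λ := (γ 0).len_pos.le.trans (hΛ 0 (by simp))
  have hQ0 : 0 ≤ Q := by positivity
  set φ : ℝ × ℝ → ℝ := fun p => ((((γ p.1).Ds ^ (k + 1)) (γ p.1).logSpeed p.2) ^ 2 +
    (((γ p.1).Ds ^ k) (γ p.1).curvature p.2) ^ 2) * (γ p.1).speed p.2 with hφ
  have sφ : ContDiff ℝ ∞ φ := ((sy.pow 2).add (sκ.pow 2)).mul (contDiff_speed hγ)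
  have hφe : (fun t => shapeEnergy k (γ t)) =
      fun t => ∫ θ in (0 : ℝ)..2 * Real.pi, φ (t, θ) := funext fun t => by
    rw [shapeEnergy, Imm.normSq, Imm.normSq, ← intervalIntegral.integral_add
      ((γ t).intervalIntegrable_normSq _ _ _) ((γ t).intervalIntegrable_normSq _ _ _)]
    refine intervalIntegral.integral_congr fun θ _ => ?_
    simp only [hφ, Real.norm_eq_abs, sq_abs]
    ring
  have hd : ∀ s θ, HasDerivAt (fun τ => φ (τ, θ))
      ((2 * ((γ s).Ds ^ (k + 1)) (γ s).logSpeed θ * velocity _ sy s θ +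
        2 * ((γ s).Ds ^ k) (γ s).curvature θ * velocity _ sκ s θ +
        ((((γ s).Ds ^ (k + 1)) (γ s).logSpeed θ) ^ 2 + (((γ s).Ds ^ k) (γ s).curvature θ) ^ 2) *
          stretch hγ s θ) * (γ s).speed θ) s := fun s θ => by
    refine ((((hasDerivAt_velocity sy s θ).pow 2).add ((hasDerivAt_velocity sκ s θ).pow 2)).mul
      (hasDerivAt_speed hγ s θ)).congr_deriv ?_
    simp only [Nat.cast_ofNat, Nat.add_one_sub_one, pow_one, Pi.add_apply, Pi.pow_apply]
    ring
  have growth := one_add_le_mul_exp (u := fun t => shapeEnergy k (γ t))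
    (by rw [hφe]; exact contDiff_parametric_integral sφ _ _) (fun t => shapeEnergy_nonneg _ _)
    (metricSpeed_continuous G hγ) (metricSpeed_nonneg G hγ) hD0 (fun s hs => by
      rw [hφe]
      refine ⟨_, hasDerivAt_integral_of_contDiff sφ (hd s), ?_⟩
      have hV := hG.integral_shapeVelocityBound_sq_le hA hk hγ (hΛ s hs)
      have hvel' := fun θ => hvel γ hγ s θ (fun i hi => (hlow s hs θ i hi).1)
        (fun i hi => (hlow s hs θ i hi).2)
      set V : ℝ → ℝ := shapeVelocityBound k (γ s) (velocity _ hγ s) with hVdef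
      have hVc : Continuous V := shapeVelocityBound_continuous _ _ _
      set y : Loop ℝ := ((γ s).Ds ^ (k + 1)) (γ s).logSpeed
      set κ : Loop ℝ := ((γ s).Ds ^ k) (γ s).curvature
      set E := shapeEnergy k (γ s) with hE
      set g := metricSpeed G hγ s
      have hg : 0 ≤ g := metricSpeed_nonneg G hγ s
      have hE0 : 0 ≤ E := shapeEnergy_nonneg _ _
      have hyc : Continuous fun θ => |y θ| + |κ θ| :=
        (loop_continuous y).abs.add (loop_continuous κ).abs
      have cs := sq_integral_mul_mul_le hyc hVc (γ s).speed_continuous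
        (fun θ => ((γ s).speed_pos θ).le) Real.two_pi_pos.le
      have hy2 : ∫ θ in (0 : ℝ)..2 * Real.pi, (|y θ| + |κ θ|) ^ 2 * (γ s).speed θ ≤ 2 * E := by
        have i2 := (γ s).intervalIntegrable_normSq y 0 (2 * Real.pi)
        have i3 := (γ s).intervalIntegrable_normSq κ 0 (2 * Real.pi)
        rw [hE, shapeEnergy, Imm.normSq, Imm.normSq, ← intervalIntegral.integral_add i2 i3,
          ← intervalIntegral.integral_const_mul]
        refine intervalIntegral.integral_mono_on Real.two_pi_pos.le
          (((hyc.pow 2).mul (γ s).speed_continuous).intervalIntegrable _ _)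
          ((i2.add i3).const_mul _) fun θ _ => ?_
        have hs := (γ s).speed_pos θ
        change _ ≤ 2 * (|y θ| ^ 2 * _ + |κ θ| ^ 2 * _)
        nlinarith [mul_nonneg (sq_nonneg (|y θ| - |κ θ|)) hs.le]
      have hI : ∫ θ in (0 : ℝ)..2 * Real.pi, (|y θ| + |κ θ|) * V θ * (γ s).speed θ ≤
          √Q * g * (2 * (1 + E)) := by
        refine abs_le_of_sq_le_sq' (cs.trans ?_) (by positivity) |>.2
        calc _ ≤ 2 * E * (Q * g ^ 2 * (1 + E)) := by
              gcongr
              exact intervalIntegral.integral_nonneg Real.two_pi_pos.le fun θ _ =>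
                mul_nonneg (sq_nonneg _) ((γ s).speed_pos θ).le
          _ ≤ 4 * (1 + E) * (Q * g ^ 2 * (1 + E)) := by gcongr <;> linarith
          _ = _ := by rw [mul_pow, mul_pow, Real.sq_sqrt hQ0]; ring
      have hpt : ∀ θ, |(2 * y θ * velocity _ sy s θ + 2 * κ θ * velocity _ sκ s θ +
          (y θ ^ 2 + κ θ ^ 2) * stretch hγ s θ) * (γ s).speed θ| ≤
            (2 * C + 1) * ((|y θ| + |κ θ|) * V θ * (γ s).speed θ) := by
        intro θ
        have hs := (γ s).speed_pos θ
        have hη : |stretch hγ s θ| ≤ ‖(γ s).Ds (velocity _ hγ s) θ‖ :=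
          (γ s).abs_tangentialPart_le _ θ
        have hV0 : 0 ≤ V θ := shapeVelocityBound_nonneg _ _ _ _
        have hVe : V θ = derivSum (γ s) (velocity _ hγ s) k θ +
          ‖(γ s).Ds (velocity _ hγ s) θ‖ * (|y θ| + |κ θ|) := rfl
        have hS0 := derivSum_nonneg (γ s) (velocity _ hγ s) k θ
        obtain ⟨v1, v2⟩ := hvel' θ
        rw [← hVe] at v1 v2
        rw [abs_mul, abs_of_pos hs]
        have r1 : |2 * y θ * velocity _ sy s θ| ≤ 2 * |y θ| * (C * V θ) := by
          rw [abs_mul, abs_mul, abs_two]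
          gcongr
        have r2 : |2 * κ θ * velocity _ sκ s θ| ≤ 2 * |κ θ| * (C * V θ) := by
          rw [abs_mul, abs_mul, abs_two]
          gcongr
        have r3 : |(y θ ^ 2 + κ θ ^ 2) * stretch hγ s θ| ≤ (|y θ| + |κ θ|) * V θ := by
          rw [abs_mul, abs_of_nonneg (by positivity)]
          calc _ ≤ (|y θ| + |κ θ|) ^ 2 * ‖(γ s).Ds (velocity _ hγ s) θ‖ := by
                gcongr
                nlinarith [sq_abs (y θ), sq_abs (κ θ), mul_nonneg (abs_nonneg (y θ))
                  (abs_nonneg (κ θ))]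
            _ = (|y θ| + |κ θ|) * (‖(γ s).Ds (velocity _ hγ s) θ‖ * (|y θ| + |κ θ|)) := by ring
            _ ≤ (|y θ| + |κ θ|) * V θ := by
                gcongr
                rw [hVe]
                linarith
        have r4 := abs_add_three (2 * y θ * velocity _ sy s θ) (2 * κ θ * velocity _ sκ s θ)
          ((y θ ^ 2 + κ θ ^ 2) * stretch hγ s θ)
        have r5 : |2 * y θ * velocity _ sy s θ + 2 * κ θ * velocity _ sκ s θ +
            (y θ ^ 2 + κ θ ^ 2) * stretch hγ s θ| ≤ (2 * C + 1) * ((|y θ| + |κ θ|) * V θ) := by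
          linarith
        exact (mul_le_mul_of_nonneg_right r5 hs.le).trans (le_of_eq (by ring))
      rw [← Real.norm_eq_abs]
      refine (intervalIntegral.norm_integral_le_of_norm_le
        (g := fun θ => (2 * C + 1) * ((|y θ| + |κ θ|) * V θ * (γ s).speed θ))
        Real.two_pi_pos.le (Filter.Eventually.of_forall fun θ _ => hpt θ)
        ((continuous_const.mul ((hyc.mul hVc).mul
          (γ s).speed_continuous)).intervalIntegrable _ _)).trans ?_
      rw [intervalIntegral.integral_const_mul]
      calc _ ≤ (2 * C + 1) * (√Q * g * (2 * (1 + E))) := by gcongr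
        _ = _ := by rw [hD]; ring) ht
  have h1 : (1 + shapeEnergy k (γ 0)) * Real.exp (D * ∫ s in (0 : ℝ)..1, metricSpeed G hγ s) ≤
      (1 + B) * Real.exp (D * N) := by gcongr
  linarith [shapeEnergy_nonneg k (γ t)]

end Shape

/-! ### Shape bounds along paths of bounded length -/

section Bounds

variable {G : RiemannianMetric} {n : ℕ} {A : ℝ}

/-- Only finitely many orders occur, so constants found for each order can be replaced by one; this
makes the final constant independent of k. -/
theorem exists_uniform_bound {P : ℕ → ℝ → Prop}
    (mono : ∀ k B B', B ≤ B' → P k B → P k B') {n m : ℕ} (h : ∀ k, k + m ≤ n → ∃ B, P k B) :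
    ∃ B, 0 ≤ B ∧ ∀ k, k + m ≤ n → P k B := by
  have key : ∀ l, ∃ B, 0 ≤ B ∧ ∀ k < l, k + m ≤ n → P k B := by
    intro l
    induction l with
    | zero => exact ⟨0, le_rfl, fun k hk => absurd hk (Nat.not_lt_zero k)⟩
    | succ l ih =>
      obtain ⟨B, hB, ih⟩ := ih
      by_cases hl : l + m ≤ n
      · obtain ⟨B', hB'⟩ := h l hl
        refine ⟨max B B', le_max_of_le_left hB, fun k hk hkm => ?_⟩
        rcases Nat.lt_succ_iff_lt_or_eq.1 hk with hk | rfl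
        · exact mono k _ _ (le_max_left _ _) (ih k hk hkm)
        · exact mono k _ _ (le_max_right _ _) hB'
      · refine ⟨B, hB, fun k hk hkm => ih k ?_ hkm⟩
        rcases Nat.lt_succ_iff_lt_or_eq.1 hk with hk | rfl
        · exact hk
        · exact absurd hkm hl
  obtain ⟨B, hB, h⟩ := key (n + 1)
  exact ⟨B, hB, fun k hk => h k (by omega) hk⟩

/-- The bounds on the shape of a curve which hold on balls for the geodesic distance of a metric
of order `n`. -/
structure ShapeBound (n : ℕ) (B : ℝ) (c : Imm) : Prop where
  len : c.len ≤ B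
  pointwise : ∀ k, k + 3 ≤ n → ∀ θ, PointwiseBound k B c θ
  energy : ∀ k, k + 2 ≤ n → shapeEnergy k c ≤ B

theorem exists_abs_loop_le (f : Loop ℝ) : ∃ B : ℝ, ∀ θ, |f θ| ≤ B := by
  obtain ⟨B, hB⟩ := (isCompact_Icc (a := (0 : ℝ)) (b := 2 * Real.pi)).exists_bound_of_continuousOn
    (loop_continuous f).continuousOn
  refine ⟨B, fun θ => ?_⟩
  obtain ⟨x, hx, hxθ⟩ := (loop_periodic f).exists_mem_Ico₀ Real.two_pi_pos θ
  rw [hxθ]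
  exact hB x ⟨hx.1, hx.2.le⟩

theorem exists_shapeBound (n : ℕ) (c : Imm) : ∃ B, 0 ≤ B ∧ ShapeBound n B c := by
  obtain ⟨B₁, h₁, hp⟩ := exists_uniform_bound (n := n) (m := 3)
    (P := fun k B => ∀ θ, PointwiseBound k B c θ) (fun k B B' hB h θ => (h θ).mono hB) (by
      intro k _
      obtain ⟨X, hX⟩ := exists_abs_loop_le ((c.Ds ^ (k + 1)) c.logSpeed)
      obtain ⟨Y, hY⟩ := exists_abs_loop_le ((c.Ds ^ k) c.curvature)
      exact ⟨max X Y, fun θ => ⟨(hX θ).trans (le_max_left _ _), (hY θ).trans (le_max_right _ _)⟩⟩)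
  obtain ⟨B₂, h₂, he⟩ := exists_uniform_bound (n := n) (m := 2)
    (P := fun k B => shapeEnergy k c ≤ B) (fun k B B' hB h => h.trans hB) fun k _ => ⟨_, le_rfl⟩
  have hl := c.len_pos
  refine ⟨c.len + B₁ + B₂, by positivity, by linarith, fun k hk θ => (hp k hk θ).mono (by linarith),
    fun k hk => (he k hk).trans (by linarith)⟩

/-- Bounds on the shape propagate along paths of bounded length. -/
theorem Coercive.exists_shapeBound (hG : Coercive G n A) (hn : 2 ≤ n) (hA : 0 < A) {B : ℝ} (N : ℝ)
    (hB : 0 ≤ B) : ∃ B' : ℝ, 0 ≤ B' ∧ ∀ (γ : ℝ → Imm)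
      (hγ : IsSmoothCurve fun t => (γ t).toLoop), ShapeBound n B (γ 0) →
      ∫ s in (0 : ℝ)..1, metricSpeed G hγ s ≤ N →
      ∀ t ∈ Set.Icc (0 : ℝ) 1, ShapeBound n B' (γ t) := by
  set Λ : ℝ := (1 + B) * Real.exp (√A * N) with hΛ
  have hΛ0 : 0 ≤ Λ := by positivity
  -- With n = m + 2, the orders i < m are exactly those with i + 3 ≤ n, where pointwise bounds are
  -- available.
  obtain ⟨m, rfl⟩ : ∃ m, n = m + 2 := ⟨n - 2, by omega⟩
  obtain ⟨B₁, h₁, hp⟩ := hG.exists_pointwiseBound hA Λ N hB m le_rfl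
  set B₃ := max B B₁
  have h₃ : 0 ≤ B₃ := le_max_of_le_left hB
  obtain ⟨B₂, h₂, he⟩ := exists_uniform_bound (n := m + 2) (m := 2)
    (P := fun k B' => ∀ (γ : ℝ → Imm) (hγ : IsSmoothCurve fun t => (γ t).toLoop),
      (∀ t ∈ Set.Icc (0 : ℝ) 1, (γ t).len ≤ Λ) →
      (∀ t ∈ Set.Icc (0 : ℝ) 1, ∀ θ, ∀ i < k, PointwiseBound i B₃ (γ t) θ) →
      shapeEnergy k (γ 0) ≤ B₃ → ∫ s in (0 : ℝ)..1, metricSpeed G hγ s ≤ N →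
      ∀ t ∈ Set.Icc (0 : ℝ) 1, shapeEnergy k (γ t) ≤ B')
    (fun k B B' hB h γ hγ a b c d t ht => (h γ hγ a b c d t ht).trans hB)
    fun k hk => hG.exists_shapeEnergy_le hA hk Λ N h₃
  refine ⟨Λ + B₁ + B₂, by positivity, fun γ hγ h0 hN => ?_⟩
  have hlen : ∀ t ∈ Set.Icc (0 : ℝ) 1, (γ t).len ≤ Λ := fun t ht => by
    have h1 := hG.len_le hn hA hγ ht
    have h2 : (1 + (γ 0).len) * Real.exp (√A * ∫ s in (0 : ℝ)..1, metricSpeed G hγ s) ≤ Λ := by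
      have := h0.len
      have := (γ 0).len_pos
      rw [hΛ]
      gcongr
    linarith
  have hlow := hp γ hγ hlen (fun θ i hi => h0.pointwise i (by omega) θ) hN
  refine fun t ht => ⟨(hlen t ht).trans (by linarith),
    fun k hk θ => (hlow t ht θ k (by omega)).mono (by linarith), fun k hk => ?_⟩
  refine (he k hk γ hγ hlen (fun t ht θ i hi => (hlow t ht θ i (by omega)).mono (le_max_right _ _))
    ((h0.energy k hk).trans (le_max_left _ _)) hN t ht).trans (by linarith)

end Bounds

/-! ### Distances in `L²` -/

theorem edist_weightedL2_le (c₁ c₂ : Imm) (f₁ f₂ : Loop ℝ) {R : ℝ} (hR : 0 ≤ R)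
    (h : ∫ θ in (0 : ℝ)..2 * Real.pi,
      (f₁ θ * √(c₁.speed θ) - f₂ θ * √(c₂.speed θ)) ^ 2 ≤ R ^ 2) :
    edist (weightedL2 c₁ f₁) (weightedL2 c₂ f₂) ≤ ENNReal.ofReal R := by
  rw [weightedL2, weightedL2, Lp.edist_toLp_toLp, MemLp.eLpNorm_eq_integral_rpow_norm
    (by simp) (by simp) ((memLp_mul_sqrt_speed c₁ f₁).sub (memLp_mul_sqrt_speed c₂ f₂))]
  refine ENNReal.ofReal_le_ofReal ?_
  rw [intervalIntegral.integral_of_le Real.two_pi_pos.le] at h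
  simp only [ENNReal.toReal_ofNat, Real.rpow_ofNat, Real.norm_eq_abs, sq_abs, Pi.sub_apply]
  rw [← one_div, ← Real.sqrt_eq_rpow]
  exact Real.sqrt_le_iff.2 ⟨hR, h⟩

theorem sqrt_speed_continuous (c : Imm) : Continuous fun θ => √(c.speed θ) :=
  c.speed_continuous.sqrt

/-- The L²(dθ) norm of f √|c'| is the L²(ds) norm of f. This crude bound serves for paths that are
not short. -/
theorem edist_weightedL2_le_of_normSq_le (c₁ c₂ : Imm) (f₁ f₂ : Loop ℝ) {B : ℝ}
    (h₁ : c₁.normSq f₁ ≤ B) (h₂ : c₂.normSq f₂ ≤ B) :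
    edist (weightedL2 c₁ f₁) (weightedL2 c₂ f₂) ≤ ENNReal.ofReal (2 * √B) := by
  refine edist_weightedL2_le _ _ _ _ (by positivity) ?_
  have hB : 0 ≤ B := (c₁.normSq_nonneg f₁).trans h₁
  have i₁ := c₁.intervalIntegrable_normSq f₁ 0 (2 * Real.pi)
  have i₂ := c₂.intervalIntegrable_normSq f₂ 0 (2 * Real.pi)
  calc _ ≤ ∫ θ in (0 : ℝ)..2 * Real.pi,
        2 * (‖f₁ θ‖ ^ 2 * c₁.speed θ + ‖f₂ θ‖ ^ 2 * c₂.speed θ) := by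
        refine intervalIntegral.integral_mono_on Real.two_pi_pos.le
          (Continuous.intervalIntegrable (((loop_continuous f₁).mul (sqrt_speed_continuous c₁)).sub
            ((loop_continuous f₂).mul (sqrt_speed_continuous c₂)) |>.pow 2) _ _)
          ((i₁.add i₂).const_mul _) fun θ _ => ?_
        have e₁ := Real.sq_sqrt (c₁.speed_pos θ).le
        have e₂ := Real.sq_sqrt (c₂.speed_pos θ).le
        rw [Real.norm_eq_abs, Real.norm_eq_abs, sq_abs, sq_abs]
        nth_rewrite 2 [← e₁]
        nth_rewrite 2 [← e₂]
        rw [← mul_pow, ← mul_pow]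
        nlinarith [sq_nonneg (f₁ θ * √(c₁.speed θ) + f₂ θ * √(c₂.speed θ))]
    _ = 2 * (c₁.normSq f₁ + c₂.normSq f₂) := by
        rw [intervalIntegral.integral_const_mul, intervalIntegral.integral_add i₁ i₂]; rfl
    _ ≤ 2 * (B + B) := by gcongr
    _ = _ := by rw [mul_pow, Real.sq_sqrt hB]; ring

/-! ### Lipschitz estimates -/

section Lipschitz

variable {G : RiemannianMetric} {n : ℕ} {A : ℝ}

/-- Minkowski's integral inequality by duality: with w the difference of the end values of f √|c'|,
the function ∫ w f √|c'| dθ of t changes by ‖w‖² over [0, 1], while its derivative is at most ‖w‖ Q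
g. Dividing by ‖w‖ gives the claim. -/
theorem integral_sq_sub_le {γ : ℝ → Imm} (hγ : IsSmoothCurve fun t => (γ t).toLoop)
    {f : ℝ → Loop ℝ} (hf : IsSmoothCurve f) {g : ℝ → ℝ} (hg : Continuous g) (hg0 : ∀ t, 0 ≤ g t)
    {Q : ℝ} (hQ : 0 ≤ Q) (h : ∀ t ∈ Set.Icc (0 : ℝ) 1, ∫ θ in (0 : ℝ)..2 * Real.pi,
      (velocity f hf t θ + 1 / 2 * (stretch hγ t θ * f t θ)) ^ 2 * (γ t).speed θ
        ≤ (Q * g t) ^ 2) :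
    ∫ θ in (0 : ℝ)..2 * Real.pi,
      (f 1 θ * √((γ 1).speed θ) - f 0 θ * √((γ 0).speed θ)) ^ 2 ≤
        (Q * ∫ t in (0 : ℝ)..1, g t) ^ 2 := by
  set F : ℝ × ℝ → ℝ := fun p => f p.1 p.2 * √((γ p.1).speed p.2) with hF
  have sF : ContDiff ℝ ∞ F := hf.mul ((contDiff_speed hγ).sqrt fun p => ((γ p.1).speed_pos p.2).ne')
  have hr : ∀ t, ContDiff ℝ ∞ fun θ => F (t, θ) := fun t =>
    sF.comp (contDiff_const.prodMk contDiff_id)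
  set w : ℝ → ℝ := fun θ => F (1, θ) - F (0, θ) with hw
  have sw : ContDiff ℝ ∞ w := (hr 1).sub (hr 0)
  have sP : ContDiff ℝ ∞ fun p : ℝ × ℝ => w p.2 * F p := (sw.comp contDiff_snd).mul sF
  set I := ∫ θ in (0 : ℝ)..2 * Real.pi, w θ ^ 2 with hI
  have hI0 : 0 ≤ I := intervalIntegral.integral_nonneg Real.two_pi_pos.le fun θ _ => sq_nonneg _
  change I ≤ _
  set d : ℝ → ℝ → ℝ := fun t θ =>
    (velocity f hf t θ + 1 / 2 * (stretch hγ t θ * f t θ)) * √((γ t).speed θ)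
  have hd : ∀ t θ, HasDerivAt (fun τ => w θ * F (τ, θ)) (w θ * d t θ) t := fun t θ => by
    have hs := (γ t).speed_pos θ
    have hs' := Real.sqrt_pos.2 hs
    refine (((hasDerivAt_velocity hf t θ).mul
      ((hasDerivAt_speed hγ t θ).sqrt hs.ne')).const_mul (w θ)).congr_deriv ?_
    simp only [d]
    have e := Real.sq_sqrt hs.le
    nth_rewrite 2 [← e]
    field_simp
  have key := abs_sub_le_of_contDiff
    (u := fun t => ∫ θ in (0 : ℝ)..2 * Real.pi, w θ * F (t, θ)) (g := g) (C := √I * Q)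
    (contDiff_parametric_integral sP _ _) hg hg0 (by positivity) (fun t ht => by
      refine ⟨_, hasDerivAt_integral_of_contDiff sP (hd t), ?_⟩
      have hdc : Continuous (d t) := ((loop_continuous _).add (continuous_const.mul
        ((loop_continuous _).mul (loop_continuous _)))).mul (sqrt_speed_continuous (γ t))
      have cs := sq_integral_mul_mul_le sw.continuous hdc (continuous_const (y := (1 : ℝ)))
        (fun _ => zero_le_one) Real.two_pi_pos.le
      simp only [mul_one] at cs
      have hdt : ∫ θ in (0 : ℝ)..2 * Real.pi, d t θ ^ 2 ≤ (Q * g t) ^ 2 := by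
        refine le_trans (le_of_eq ?_) (h t ht)
        refine intervalIntegral.integral_congr fun θ _ => ?_
        simp only [d]
        rw [mul_pow, Real.sq_sqrt ((γ t).speed_pos θ).le]
      refine abs_le_of_sq_le_sq (cs.trans ?_) (mul_nonneg (by positivity) (hg0 t))
      rw [mul_assoc, mul_pow √I, Real.sq_sqrt hI0]
      gcongr) (Set.right_mem_Icc.2 zero_le_one)
  have i : ∀ t, IntervalIntegrable (fun θ => w θ * F (t, θ)) volume 0 (2 * Real.pi) := fun t =>
    (sw.continuous.mul (hr t).continuous).intervalIntegrable _ _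
  have hdiff : (∫ θ in (0 : ℝ)..2 * Real.pi, w θ * F (1, θ)) -
      ∫ θ in (0 : ℝ)..2 * Real.pi, w θ * F (0, θ) = I := by
    rw [← intervalIntegral.integral_sub (i 1) (i 0)]
    refine intervalIntegral.integral_congr fun θ _ => ?_
    simp only [hw]
    ring
  rw [hdiff, abs_of_nonneg hI0] at key
  set L := ∫ t in (0 : ℝ)..1, g t
  have hL : 0 ≤ L := intervalIntegral.integral_nonneg zero_le_one fun t _ => hg0 t
  rcases hI0.eq_or_lt with h0 | h0
  · rw [← h0]; positivity
  · have h1 : √I * √I ≤ √I * (Q * L) := by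
      rw [Real.mul_self_sqrt hI0, ← mul_assoc]
      exact key
    have h2 : √I ≤ Q * L := le_of_mul_le_mul_left h1 (Real.sqrt_pos.2 h0)
    exact (Real.sqrt_le_left (by positivity)).1 h2

/-- The maps of order `k` are Lipschitz along a path, with constant `C`. -/
def LipschitzAlong (G : RiemannianMetric) (k : ℕ) (C : ℝ) (γ : ℝ → Imm)
    (hγ : IsSmoothCurve fun t => (γ t).toLoop) : Prop :=
  edist (curvatureMap k (γ 0)) (curvatureMap k (γ 1)) ≤ ENNReal.ofReal C * pathLength G γ hγ ∧
  edist (logSpeedMap k (γ 0)) (logSpeedMap k (γ 1)) ≤ ENNReal.ofReal C * pathLength G γ hγ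

theorem LipschitzAlong.mono {k : ℕ} {C C' : ℝ} {γ : ℝ → Imm}
    {hγ : IsSmoothCurve fun t => (γ t).toLoop} (h : LipschitzAlong G k C γ hγ) (hC : C ≤ C') :
    LipschitzAlong G k C' γ hγ :=
  ⟨h.1.trans (by gcongr), h.2.trans (by gcongr)⟩

/-- The hypothesis on f covers both y_k and κ_k, and makes |a f| at most the velocity bound; hence C
+ 1 in place of C. -/
theorem Coercive.integral_sq_velocity_le (hG : Coercive G n A) (hA : 0 < A) {k : ℕ}
    (hk : k + 2 ≤ n) {γ : ℝ → Imm} (hγ : IsSmoothCurve fun t => (γ t).toLoop) {Λ t : ℝ}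
    (hΛ : (γ t).len ≤ Λ) {f f' : Loop ℝ} {C : ℝ}
    (hf' : ∀ θ, |f' θ| ≤ C * shapeVelocityBound k (γ t) (velocity _ hγ t) θ)
    (hf : ∀ θ, |f θ| ≤
      |((γ t).Ds ^ (k + 1)) (γ t).logSpeed θ| + |((γ t).Ds ^ k) (γ t).curvature θ|) :
    ∫ θ in (0 : ℝ)..2 * Real.pi,
        (f' θ + 1 / 2 * (stretch hγ t θ * f θ)) ^ 2 * (γ t).speed θ ≤
      (C + 1) ^ 2 * ((2 * (k + 2) ^ 2 * A + 4 * (Λ * A)) * metricSpeed G hγ t ^ 2 *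
        (1 + shapeEnergy k (γ t))) := by
  have hV := hG.integral_shapeVelocityBound_sq_le hA hk hγ hΛ
  have hst : ∀ θ, |stretch hγ t θ| ≤ ‖(γ t).Ds (velocity _ hγ t) θ‖ :=
    (γ t).abs_tangentialPart_le _
  set c := γ t
  set h := velocity _ hγ t
  set V := shapeVelocityBound k c h with hVdef
  have hVc : Continuous V := shapeVelocityBound_continuous _ _ _
  have hlc : Continuous fun θ => (f' θ + 1 / 2 * (stretch hγ t θ * f θ)) ^ 2 * c.speed θ :=
    (((loop_continuous f').add (continuous_const.mul
      ((loop_continuous _).mul (loop_continuous f)))).pow 2).mul c.speed_continuous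
  have hrc : Continuous fun θ => (C + 1) ^ 2 * (V θ ^ 2 * c.speed θ) :=
    continuous_const.mul ((hVc.pow 2).mul c.speed_continuous)
  refine le_trans ?_ (mul_le_mul_of_nonneg_left hV (sq_nonneg (C + 1)))
  rw [← intervalIntegral.integral_const_mul]
  refine intervalIntegral.integral_mono_on Real.two_pi_pos.le (hlc.intervalIntegrable _ _)
    (hrc.intervalIntegrable _ _) fun θ _ => ?_
  rw [← mul_assoc ((C + 1) ^ 2), ← mul_pow]
  refine mul_le_mul_of_nonneg_right ?_ (c.speed_pos θ).le
  have h1 := hf' θ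
  have hV0 : 0 ≤ V θ := shapeVelocityBound_nonneg _ _ _ _
  have h2 : |stretch hγ t θ * f θ| ≤ V θ := by
    rw [abs_mul]
    exact (mul_le_mul (hst θ) (hf θ) (abs_nonneg _) (norm_nonneg _)).trans
      (le_add_of_nonneg_left (derivSum_nonneg _ _ _ _))
  have h3 := abs_add_le (f' θ) (1 / 2 * (stretch hγ t θ * f θ))
  rw [abs_mul (1 / 2 : ℝ), abs_of_pos (by norm_num : (0 : ℝ) < 1 / 2)] at h3
  have h4 := h3.trans (show _ ≤ (C + 1) * V θ by linarith)
  exact sq_le_sq' (abs_le.1 h4).1 (abs_le.1 h4).2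

theorem Coercive.edist_weightedL2_path_le (hG : Coercive G n A) (hA : 0 < A) {k : ℕ}
    (hk : k + 2 ≤ n) {γ : ℝ → Imm} (hγ : IsSmoothCurve fun t => (γ t).toLoop) {B : ℝ}
    (hB : 0 ≤ B) (hb : ∀ t ∈ Set.Icc (0 : ℝ) 1, ShapeBound n B (γ t))
    {f : ℝ → Loop ℝ} (hf : IsSmoothCurve f) {C : ℝ} (hC : 0 ≤ C)
    (hf' : ∀ t ∈ Set.Icc (0 : ℝ) 1, ∀ θ, |velocity f hf t θ| ≤
      C * shapeVelocityBound k (γ t) (velocity _ hγ t) θ)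
    (hfb : ∀ t θ, |f t θ| ≤
      |((γ t).Ds ^ (k + 1)) (γ t).logSpeed θ| + |((γ t).Ds ^ k) (γ t).curvature θ|) :
    edist (weightedL2 (γ 0) (f 0)) (weightedL2 (γ 1) (f 1)) ≤ ENNReal.ofReal
      ((C + 1) * √((2 * (k + 2) ^ 2 * A + 4 * (B * A)) * (1 + B))) * pathLength G γ hγ := by
  set P : ℝ := (2 * (k + 2) ^ 2 * A + 4 * (B * A)) * (1 + B) with hPdef
  have hP : 0 ≤ P := by positivity
  have hQ : 0 ≤ (C + 1) * √P := by positivity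
  rw [pathLength_eq, ← ENNReal.ofReal_mul hQ, edist_comm]
  refine edist_weightedL2_le _ _ _ _ (mul_nonneg hQ (integral_metricSpeed_nonneg G hγ)) ?_
  refine integral_sq_sub_le hγ hf (metricSpeed_continuous G hγ) (metricSpeed_nonneg G hγ) hQ
    fun t ht => ?_
  refine (hG.integral_sq_velocity_le hA hk hγ (hb t ht).len (hf' t ht) (hfb t)).trans ?_
  have hE := (hb t ht).energy k hk
  rw [mul_pow, mul_pow, Real.sq_sqrt hP, hPdef, mul_assoc ((C + 1) ^ 2)]
  refine mul_le_mul_of_nonneg_left ?_ (sq_nonneg _)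
  rw [mul_right_comm _ (1 + B)]
  gcongr

theorem Coercive.exists_lipschitzAlong (hG : Coercive G n A) (hA : 0 < A) {k : ℕ}
    (hk : k + 2 ≤ n) {B : ℝ} (hB : 0 ≤ B) : ∃ C : ℝ, ∀ (γ : ℝ → Imm)
      (hγ : IsSmoothCurve fun t => (γ t).toLoop), (∀ t ∈ Set.Icc (0 : ℝ) 1, ShapeBound n B (γ t)) →
      LipschitzAlong G k C γ hγ := by
  obtain ⟨C, hC, hvel⟩ := exists_abs_velocity_le B hB k
  refine ⟨(C + 1) * √((2 * (k + 2) ^ 2 * A + 4 * (B * A)) * (1 + B)), fun γ hγ hb => ?_⟩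
  have hvel' := fun t (ht : t ∈ Set.Icc (0 : ℝ) 1) θ => hvel γ hγ t θ
    (fun i hi => ((hb t ht).pointwise i (by omega) θ).1)
    (fun i hi => ((hb t ht).pointwise i (by omega) θ).2)
  exact ⟨hG.edist_weightedL2_path_le hA hk hγ hB hb
      (isSmoothCurve_Ds_pow hγ (isSmoothCurve_curvature hγ) k) hC
      (fun t ht θ => (hvel' t ht θ).2) fun t θ => le_add_of_nonneg_left (abs_nonneg _),
    hG.edist_weightedL2_path_le hA hk hγ hB hb
      (isSmoothCurve_Ds_pow hγ (isSmoothCurve_logSpeed hγ) (k + 1)) hC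
      (fun t ht θ => (hvel' t ht θ).1) fun t θ => le_add_of_nonneg_right (abs_nonneg _)⟩

theorem exists_path_of_geodesicDist_lt {c₁ c₂ : Imm} {r : ℝ≥0∞} (h : geodesicDist G c₁ c₂ < r) :
    ∃ (γ : ℝ → Imm) (hγ : IsSmoothCurve fun t => (γ t).toLoop), γ 0 = c₁ ∧ γ 1 = c₂ ∧
      pathLength G γ hγ < r := by
  simpa only [geodesicDist, iInf_lt_iff, exists_prop] using h

theorem geodesicDist_self (c : Imm) : geodesicDist G c c = 0 := by
  have hγ : IsSmoothCurve fun _ : ℝ => c.toLoop := (loop_contDiff c.toLoop).comp contDiff_snd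
  refine nonpos_iff_eq_zero.1 (iInf_le_of_le (fun _ => c) (iInf_le_of_le hγ
    (iInf_le_of_le rfl (iInf_le_of_le rfl ?_))))
  have hv : ∀ t, velocity _ hγ t = 0 := fun t =>
    loop_ext fun θ => velocity_eq_of_hasDerivAt hγ (hasDerivAt_const t _)
  simp [pathLength, hv]

theorem Coercive.lipschitzOnMetricBalls (hG : Coercive G n A) (hn : 2 ≤ n) (hA : 0 < A) :
    LipschitzOnMetricBalls G n := by
  have lip : ∀ (c₀ : Imm) (N : ℝ≥0), 0 < N → ∃ C : ℝ≥0, ∀ c₁ c₂ : Imm,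
      geodesicDist G c₀ c₁ < N → geodesicDist G c₀ c₂ < N → ∀ k : ℕ, k + 2 ≤ n →
        edist (curvatureMap k c₁) (curvatureMap k c₂) ≤ C * geodesicDist G c₁ c₂ ∧
        edist (logSpeedMap k c₁) (logSpeedMap k c₂) ≤ C * geodesicDist G c₁ c₂ := by
    intro c₀ N _
    -- `B₀` holds at the centre, `B₁` on the ball, and `B₂` along every path of length at most 1
    -- that starts in the ball, even where it leaves the ball.
    obtain ⟨B₀, hB₀, hc₀⟩ := PlaneCurves.exists_shapeBound n c₀
    obtain ⟨B₁, hB₁, h₁⟩ := hG.exists_shapeBound hn hA N hB₀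
    obtain ⟨B₂, hB₂, h₂⟩ := hG.exists_shapeBound hn hA 1 hB₁
    obtain ⟨C, hC, hlip⟩ := exists_uniform_bound (n := n) (m := 2)
      (P := fun k C => ∀ (γ : ℝ → Imm) (hγ : IsSmoothCurve fun t => (γ t).toLoop),
        (∀ t ∈ Set.Icc (0 : ℝ) 1, ShapeBound n B₂ (γ t)) → LipschitzAlong G k C γ hγ)
      (fun k C C' hC h γ hγ hb => (h γ hγ hb).mono hC)
      fun k hk => hG.exists_lipschitzAlong hA hk hB₂
    have ball : ∀ c, geodesicDist G c₀ c < N → ShapeBound n B₁ c := by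
      intro c hc
      obtain ⟨γ, hγ, h0, h1, hl⟩ := exists_path_of_geodesicDist_lt hc
      rw [pathLength_eq] at hl
      rw [← h1]
      refine h₁ γ hγ (h0 ▸ hc₀) ?_ 1 (Set.right_mem_Icc.2 zero_le_one)
      rw [← ENNReal.ofReal_coe_nnreal] at hl
      exact ((ENNReal.ofReal_lt_ofReal_iff_of_nonneg (integral_metricSpeed_nonneg G hγ)).1 hl).le
    have hM : 0 < C + 2 * √B₁ + 1 := by positivity
    refine ⟨(C + 2 * √B₁ + 1).toNNReal, fun c₁ c₂ hc₁ hc₂ k hk => ?_⟩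
    rw [ENNReal.ofNNReal_toNNReal]
    set M := C + 2 * √B₁ + 1 with hMdef
    have hM0 : ENNReal.ofReal M ≠ 0 := by simpa using hM
    have path : ∀ (γ : ℝ → Imm) (hγ : IsSmoothCurve fun t => (γ t).toLoop), γ 0 = c₁ → γ 1 = c₂ →
        LipschitzAlong G k M γ hγ := by
      intro γ hγ h0 h1
      have b0 : ShapeBound n B₁ (γ 0) := h0 ▸ ball c₁ hc₁
      have b1 : ShapeBound n B₁ (γ 1) := h1 ▸ ball c₂ hc₂
      -- Short paths are covered by the estimate along paths. For long ones, the distance of the end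
      -- values is at most 2√B₁, hence at most 2√B₁ times the length.
      rcases le_total (∫ s in (0 : ℝ)..1, metricSpeed G hγ s) 1 with hl | hl
      · exact (hlip k hk γ hγ (h₂ γ hγ b0 hl)).mono (by rw [hMdef]; linarith [Real.sqrt_nonneg B₁])
      · have far : ENNReal.ofReal (2 * √B₁) ≤ ENNReal.ofReal M * pathLength G γ hγ := by
          rw [pathLength_eq, ← ENNReal.ofReal_mul hM.le]
          refine ENNReal.ofReal_le_ofReal ?_
          nlinarith
        have e0 := b0.energy k hk
        have e1 := b1.energy k hk
        rw [shapeEnergy] at e0 e1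
        have n0 := (γ 0).normSq_nonneg (((γ 0).Ds ^ (k + 1)) (γ 0).logSpeed)
        have n0' := (γ 0).normSq_nonneg (((γ 0).Ds ^ k) (γ 0).curvature)
        have n1 := (γ 1).normSq_nonneg (((γ 1).Ds ^ (k + 1)) (γ 1).logSpeed)
        have n1' := (γ 1).normSq_nonneg (((γ 1).Ds ^ k) (γ 1).curvature)
        exact ⟨(edist_weightedL2_le_of_normSq_le _ _ _ _ (by linarith) (by linarith)).trans far,
          (edist_weightedL2_le_of_normSq_le _ _ _ _ (by linarith) (by linarith)).trans far⟩
    have pass : ∀ x : ℝ≥0∞, (∀ (γ : ℝ → Imm) (hγ : IsSmoothCurve fun t => (γ t).toLoop),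
        γ 0 = c₁ → γ 1 = c₂ → x ≤ ENNReal.ofReal M * pathLength G γ hγ) →
        x ≤ ENNReal.ofReal M * geodesicDist G c₁ c₂ := by
      intro x hx
      -- Dividing by M brings the infimum over paths to the outside; this is where M must be
      -- nonzero, which the summand 1 in its definition ensures.
      refine (ENNReal.div_le_iff' hM0 ENNReal.ofReal_ne_top).1 ?_
      exact le_iInf fun γ => le_iInf fun hγ => le_iInf fun h0 => le_iInf fun h1 =>
        (ENNReal.div_le_iff' hM0 ENNReal.ofReal_ne_top).2 (hx γ hγ h0 h1)
    constructor
    · refine pass _ fun γ hγ h0 h1 => ?_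
      have := (path γ hγ h0 h1).1
      rwa [h0, h1] at this
    · refine pass _ fun γ hγ h0 h1 => ?_
      have := (path γ hγ h0 h1).2
      rwa [h0, h1] at this
  have cont : ∀ Φ : Imm → L2Circle, (∀ c₀ : Imm, ∃ C : ℝ≥0, ∀ c : Imm, geodesicDist G c₀ c < 1 →
      edist (Φ c₀) (Φ c) ≤ C * geodesicDist G c₀ c) → GeodesicContinuous G Φ := by
    intro Φ hΦ c₀ ε hε
    obtain ⟨C, hC⟩ := hΦ c₀
    have hC0 : ((C + 1 : ℝ≥0) : ℝ≥0∞) ≠ 0 := by simp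
    -- The 1 keeps c in the unit ball where the Lipschitz estimate holds, and C + 1 avoids division
    -- by zero.
    refine ⟨min 1 (ε / (C + 1 : ℝ≥0)), lt_min one_pos (ENNReal.div_pos hε.ne' ENNReal.coe_ne_top),
      fun c hc => ?_⟩
    have h1 := (ENNReal.lt_div_iff_mul_lt (Or.inl hC0) (Or.inl ENNReal.coe_ne_top)).1
      (hc.trans_le (min_le_right _ _))
    refine (hC c (hc.trans_le (min_le_left _ _))).trans_lt (lt_of_le_of_lt ?_ h1)
    rw [mul_comm]
    gcongr
    simp
  refine ⟨lip, fun k hk => ⟨cont _ fun c₀ => ?_, cont _ fun c₀ => ?_⟩⟩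
  · obtain ⟨C, hC⟩ := lip c₀ 1 one_pos
    exact ⟨C, fun c hc => (hC c₀ c (by simp [geodesicDist_self]) (by simpa using hc) k hk).1⟩
  · obtain ⟨C, hC⟩ := lip c₀ 1 one_pos
    exact ⟨C, fun c hc => (hC c₀ c (by simp [geodesicDist_self]) (by simpa using hc) k hk).2⟩

/-! ### Coercivity of Sobolev metrics -/

theorem Imm.integral_add_eq_normSq (c : Imm) (h k : Loop Plane) :
    ∫ θ in (0 : ℝ)..2 * Real.pi, (‖h θ‖ ^ 2 + ‖k θ‖ ^ 2) * c.speed θ =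
      c.normSq h + c.normSq k := by
  simp only [add_mul]
  exact intervalIntegral.integral_add (c.intervalIntegrable_normSq _ _ _)
    (c.intervalIntegrable_normSq _ _ _)

/-- The intermediate terms are nonnegative and are dropped. The constant dominates both 1/a_0 and
1/a_n; 0 and n are distinct indices because n ≥ 2. -/
theorem coercive_sobolevMetric (hn : 2 ≤ n) (a : ℕ → ℝ) (ha : ∀ j ≤ n, 0 ≤ a j) (ha0 : a 0 ≠ 0)
    (han : a n ≠ 0) : Coercive (sobolevMetric n a ha ha0 han) n ((a 0)⁻¹ + (a n)⁻¹) := by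
  intro c h
  have p0 : 0 < a 0 := lt_of_le_of_ne (ha 0 (Nat.zero_le n)) ha0.symm
  have pn : 0 < a n := lt_of_le_of_ne (ha n le_rfl) han.symm
  change _ ≤ _ * ∫ θ in (0 : ℝ)..2 * Real.pi, sobolevIntegrand n a c h h θ
  rw [← c.integral_add_eq_normSq, ← intervalIntegral.integral_const_mul]
  refine intervalIntegral.integral_mono_on Real.two_pi_pos.le
    (Continuous.intervalIntegrable ((((loop_continuous _).norm.pow 2).add
      ((loop_continuous _).norm.pow 2)).mul c.speed_continuous) _ _)
    ((continuous_const.mul (sobolevIntegrand_continuous n a c h h)).intervalIntegrable _ _)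
    fun θ _ => ?_
  rw [sobolevIntegrand, ← mul_assoc]
  refine mul_le_mul_of_nonneg_right ?_ (c.speed_pos θ).le
  have hsum : ∑ j ∈ ({0, n} : Finset ℕ), a j * ⟪(c.Ds ^ j) h θ, (c.Ds ^ j) h θ⟫ ≤
      ∑ j ∈ Finset.range (n + 1), a j * ⟪(c.Ds ^ j) h θ, (c.Ds ^ j) h θ⟫ := by
    refine Finset.sum_le_sum_of_subset_of_nonneg ?_ fun j hj _ => mul_nonneg
      (ha j (Nat.lt_succ_iff.1 (Finset.mem_range.1 hj))) real_inner_self_nonneg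
    intro j hj
    rcases Finset.mem_insert.1 hj with rfl | hj
    · simp
    · rw [Finset.mem_singleton.1 hj]; simp
  rw [Finset.sum_pair (by omega)] at hsum
  simp only [pow_zero, Module.End.one_apply, real_inner_self_eq_norm_sq] at hsum ⊢
  refine le_trans ?_ (mul_le_mul_of_nonneg_left hsum (by positivity))
  have e : ((a 0)⁻¹ + (a n)⁻¹) * (a 0 * ‖h θ‖ ^ 2 + a n * ‖(c.Ds ^ n) h θ‖ ^ 2) =
      ‖h θ‖ ^ 2 + ‖(c.Ds ^ n) h θ‖ ^ 2 + (a n)⁻¹ * a 0 * ‖h θ‖ ^ 2 +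
        (a 0)⁻¹ * a n * ‖(c.Ds ^ n) h θ‖ ^ 2 := by
    field_simp
    ring
  rw [e]
  have : 0 ≤ (a n)⁻¹ * a 0 * ‖h θ‖ ^ 2 := by positivity
  have : 0 ≤ (a 0)⁻¹ * a n * ‖(c.Ds ^ n) h θ‖ ^ 2 := by positivity
  linarith

end Lipschitz

end PlaneCurves

end

theorem theorem4p6 (n : ℕ) (hn : 2 ≤ n) :
    (∀ (G : PlaneCurves.RiemannianMetric) (A : ℝ), 0 < A →
      (∀ (c : PlaneCurves.Imm) (h : PlaneCurves.Loop PlaneCurves.Plane),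
        ∫ θ in (0 : ℝ)..2 * Real.pi, (‖h θ‖ ^ 2 + ‖(c.Ds ^ n) h θ‖ ^ 2) * c.speed θ
          ≤ A * G.form c h h) →
      PlaneCurves.LipschitzOnMetricBalls G n) ∧
    (∀ (a : ℕ → ℝ) (ha : ∀ j ≤ n, 0 ≤ a j) (ha0 : a 0 ≠ 0) (han : a n ≠ 0),
      PlaneCurves.LipschitzOnMetricBalls (PlaneCurves.sobolevMetric n a ha ha0 han) n) := by
  refine ⟨fun G A hA hG => ?_, fun a ha ha0 han => ?_⟩
  · have hcoercive : PlaneCurves.Coercive G n A := fun c h => by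
      rw [← c.integral_add_eq_normSq]
      exact hG c h
    exact hcoercive.lipschitzOnMetricBalls hn hA
  · have p0 : 0 < a 0 := lt_of_le_of_ne (ha 0 (Nat.zero_le n)) ha0.symm
    have pn : 0 < a n := lt_of_le_of_ne (ha n le_rfl) han.symm
    exact (PlaneCurves.coercive_sobolevMetric hn a ha ha0 han).lipschitzOnMetricBalls hn
      (by positivity)
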